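/- Let $F_v=\mathbb{R}$ or $\mathbb{C}$, with normalised absolute value $|x|_v=|x|$ for $F_v=\mathbb{R}$ and $|x|_v=|x|^2=x\bar x$ for $F_v=\mathbb{C}$, additive character $\psi_v(x)=e^{2\pi i x}$ for $\mathbb{R}$ and $\psi_v(x)=e^{4\pi i\,\mathrm{Re}(x)}$ for $\mathbb{C}$, and the corresponding self-dual measure $dx$ (Lebesgue measure for $\mathbb{R}$, twice Lebesgue measure for $\mathbb{C}$). Let $\widehat f(x)=\int_{F_v}f(u)\psi_v(xu)\,du$ be the Fourier transform, extended to $L^2(F_v)$. For $\mathrm{Re}(\mu)\ge 0$ let $H^{\mu}(F_v)$ be the Sobolev space of all $f\in L^2(F_v)$ with $(1+|x|_v^2)^{\mathrm{Re}(\mu)/2}\widehat f(x)\in L^2(F_v)$. For $\mathrm{Re}(s)\le 1/2$ the Hankel transform on $H^{1-2s}(F_v)$ is $$\mathcal{H}_s(f)=\big(|x|_v^{2s-2}\,\widehat f(1/x)\big)^{\widehat{\ }}.$$ For $g\in \mathrm{GL}_2(F_v)$ with Iwasawa decomposition $g=k\begin{pmatrix}t_1&0\\0&t_2\end{pmatrix}\begin{pmatrix}1&0\\c&1\end{pmatrix}$,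 where $k$ lies in the maximal compact subgroup $\mathrm{O}(2)$ or $\mathrm{U}(2)$, put $t(g)=|t_1/t_2|_v^{1/2}$, and let $\nu(x)=\begin{pmatrix}1&x\\0&1\end{pmatrix}$. Put $\zeta_{\mathbb{R}}(s)=\pi^{-s/2}\Gamma(s/2)$ and $\zeta_{\mathbb{C}}(s)=(2\pi)^{1-s}\Gamma(s)$. The basic function is $$\mathbb{L}_v(u)=\mathbb{L}_v(u,s)=\zeta_{F_v}(2-2s)\int_{F_v}\psi_v(ux)\,t(\nu(x))^{2-2s}\,dx\qquad(\mathrm{Re}(s)<1/2),$$ and it is defined by meromorphic continuation in $s$ otherwise. Let $s\in\mathbb{C}$ with $\mathrm{Re}(s)\le 1/2$. (a) If $F_v=\mathbb{C}$, then for every integer $n\ge 0$ the functions $u^n\mathbb{L}_v$ and $\bar u^n\mathbb{L}_v$ lie in $H^{1-2s}(\mathbb{C})$, and, almost everywhere, $$\mathcal{H}_s(u^n\mathbb{L}_v)=(-1)^n\bar u^n\mathbb{L}_v,\qquad \mathcal{H}_s(\bar u^n\mathbb{L}_v)=(-1)^nu^n\mathbb{L}_v.$$ (b) If $F_v=\mathbb{R}$,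 then for $n\in\{0,1\}$ the function $u^n\mathbb{L}_v$ lies in $H^{1-2s}(\mathbb{R})$, and, almost everywhere, $$\mathcal{H}_s(u^n\mathbb{L}_v)=(-1)^nu^n\mathbb{L}_v.$$ -/

import Mathlib

open MeasureTheory Complex
open scoped ComplexConjugate FourierTransform SchwartzMap Real

noncomputable section

namespace ArchHankel

/-! ### The normalised absolute value and the Iwasawa height

Here `𝕜` is `ℝ` or `ℂ`. -/

section Height

variable {𝕜 : Type*} [RCLike 𝕜]

/-- The normalised absolute value `|x|_v`: it is `|x|` on `ℝ` and `|x|²` on `ℂ`. -/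
def vAbs (x : 𝕜) : ℝ := ‖x‖ ^ Module.finrank ℝ 𝕜

/-- The upper triangular unipotent matrix `ν(x)`. -/
def nu (x : 𝕜) : Matrix (Fin 2) (Fin 2) 𝕜 := !![1, x; 0, 1]

/-- The height `t(g) = |t₁ / t₂|_v ^ (1/2)`, where `g = k a(t₁, t₂) n(c)` is an Iwasawa
decomposition: `k` lies in the standard maximal compact subgroup (`O(2)` or `U(2)`),
`a(t₁, t₂)` is diagonal and `n(c)` is lower triangular unipotent. The value does not depend on the
decomposition, so that the set below is a singleton. -/
def height (g : Matrix (Fin 2) (Fin 2) 𝕜) : ℝ :=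
  sSup {r : ℝ | ∃ k ∈ Matrix.unitaryGroup (Fin 2) 𝕜, ∃ t₁ t₂ c : 𝕜, t₁ ≠ 0 ∧ t₂ ≠ 0 ∧
    g = k * !![t₁, 0; 0, t₂] * !![1, 0; c, 1] ∧ r = vAbs (t₁ / t₂) ^ (1 / 2 : ℝ)}

end Height

/-- The meromorphic continuation to `ℂ` of a function `f` given on `U` (a nonempty open set). Values
at isolated singularities are normalised: `g` has its limit value at a removable singularity and the
value `0` at a pole. If there is no continuation, the value is `0`. -/
def meromorphicContinuation (f : ℂ → ℂ) (U : Set ℂ) : ℂ → ℂ :=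
  open Classical in
  if h : ∃ g : ℂ → ℂ, MeromorphicNFOn g Set.univ ∧ Set.EqOn g f U then h.choose else 0

/-! ### The real place -/

namespace RealPlace

/-- The additive character `ψ(x) = exp(2πix)`. The self-dual measure is the Lebesgue measure. -/
def psi (x : ℝ) : ℂ := cexp (2 * π * I * x)

/-- The local zeta factor `π^(-s/2) Γ(s/2)`. -/
def zeta (s : ℂ) : ℂ := (π : ℂ) ^ (-s / 2) * Gamma (s / 2)

/-- The integral that defines the basic function for `Re s < 1/2`. -/
def basicIntegral (u : ℝ) (s : ℂ) : ℂ :=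
  zeta (2 - 2 * s) * ∫ x : ℝ, psi (u * x) * (height (nu x) : ℂ) ^ (2 - 2 * s)

/-- The basic function `𝕃(u, s)`, by meromorphic continuation in `s` from `Re s < 1/2`. -/
def basicFunction (u : ℝ) (s : ℂ) : ℂ :=
  meromorphicContinuation (basicIntegral u) {s | s.re < 1 / 2} s

/-- The Fourier transform `f̂(x) = ∫ f(u) ψ(xu) du` on `L²(ℝ)`, as a function up to null sets. With
Mathlib's sign convention this is the inverse Fourier transform. -/
def fourier (f : ℝ → ℂ) : ℝ → ℂ :=
  open Classical in
  if hf : MemLp f 2 volume then fun x => (𝓕⁻ (hf.toLp f) : Lp ℂ 2 (volume : Measure ℝ)) x else 0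

/-- The Sobolev space `H^μ(ℝ)` for `Re μ ≥ 0`. -/
def MemSobolev (μ : ℂ) (f : ℝ → ℂ) : Prop :=
  MemLp f 2 volume ∧
    MemLp (fun x : ℝ => (((1 + vAbs x ^ 2) ^ (μ.re / 2) : ℝ) : ℂ) * fourier f x) 2 volume

/-- The Hankel transform `𝓗_s f = (|x|^(2s-2) f̂(1/x))^` on `H^(1-2s)(ℝ)`, for `Re s ≤ 1/2`. -/
def hankel (s : ℂ) (f : ℝ → ℂ) : ℝ → ℂ :=
  fourier fun x => (vAbs x : ℂ) ^ (2 * s - 2) * fourier f (1 / x)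

end RealPlace

/-! ### The complex place -/

namespace ComplexPlace

/-- The additive character `ψ(x) = exp(4πi Re x)`. -/
def psi (x : ℂ) : ℂ := cexp (4 * π * I * x.re)

/-- The self-dual measure with respect to `psi`: twice the Lebesgue measure. -/
def selfDual : Measure ℂ := (2 : ENNReal) • volume

/-- The local zeta factor `(2π)^(1-s) Γ(s)`. -/
def zeta (s : ℂ) : ℂ := (2 * π : ℂ) ^ (1 - s) * Gamma s

/-- The integral that defines the basic function for `Re s < 1/2`. -/
def basicIntegral (u : ℂ) (s : ℂ) : ℂ :=
  zeta (2 - 2 * s) * ∫ x : ℂ, psi (u * x) * (height (nu x) : ℂ) ^ (2 - 2 * s) ∂selfDual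

/-- The basic function `𝕃(u, s)`, by meromorphic continuation in `s` from `Re s < 1/2`. -/
def basicFunction (u : ℂ) (s : ℂ) : ℂ :=
  meromorphicContinuation (basicIntegral u) {s | s.re < 1 / 2} s

/-- The Fourier transform `f̂(x) = ∫ f(u) ψ(xu) du` on `L²(ℂ)`, where `du` is the self-dual measure,
as a function up to null sets. Since `ψ(xu) = exp(2πi ⟨u, 2x̄⟩)` for the real inner product
`⟨u, w⟩ = Re(ūw)` on `ℂ`, it is `2 (𝓕⁻ f)(2x̄)`; see `fourier_schwartz`. -/
def fourier (f : ℂ → ℂ) : ℂ → ℂ :=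
  open Classical in
  if hf : MemLp f 2 volume then
    fun x => 2 * (𝓕⁻ (hf.toLp f) : Lp ℂ 2 (volume : Measure ℂ)) (2 * conj x)
  else 0

/-- The Sobolev space `H^μ(ℂ)` for `Re μ ≥ 0`. -/
def MemSobolev (μ : ℂ) (f : ℂ → ℂ) : Prop :=
  MemLp f 2 selfDual ∧
    MemLp (fun x : ℂ => (((1 + vAbs x ^ 2) ^ (μ.re / 2) : ℝ) : ℂ) * fourier f x) 2 selfDual

/-- The Hankel transform `𝓗_s f = (|x|_v^(2s-2) f̂(1/x))^` on `H^(1-2s)(ℂ)`, for `Re s ≤ 1/2`. -/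
def hankel (s : ℂ) (f : ℂ → ℂ) : ℂ → ℂ :=
  fourier fun x => (vAbs x : ℂ) ^ (2 * s - 2) * fourier f (1 / x)

end ComplexPlace

/-! ### Checks of the definitions -/

section Height

variable {𝕜 : Type*} [RCLike 𝕜]

theorem height_nu (x : 𝕜) :
    height (nu x) = (((1 + ‖x‖ ^ 2)⁻¹ : ℝ) ^ Module.finrank ℝ 𝕜) ^ (1 / 2 : ℝ) := by
  have hpos : (0 : ℝ) < 1 + ‖x‖ ^ 2 := by positivity
  have hset : {r : ℝ | ∃ k ∈ Matrix.unitaryGroup (Fin 2) 𝕜, ∃ t₁ t₂ c : 𝕜, t₁ ≠ 0 ∧ t₂ ≠ 0 ∧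
      nu x = k * !![t₁, 0; 0, t₂] * !![1, 0; c, 1] ∧ r = vAbs (t₁ / t₂) ^ (1 / 2 : ℝ)} =
      {(((1 + ‖x‖ ^ 2)⁻¹ : ℝ) ^ Module.finrank ℝ 𝕜) ^ (1 / 2 : ℝ)} := by
    ext r
    simp only [Set.mem_ofPred_eq, Set.mem_singleton_iff]
    constructor
    · rintro ⟨k, hk, t₁, t₂, c, h1, h2, hg, rfl⟩
      have hkk := (Matrix.mem_unitaryGroup_iff').1 hk
      have key : (nu x).conjTranspose * nu x =
          (!![t₁, 0; 0, t₂] * !![1, 0; c, 1] : Matrix (Fin 2) (Fin 2) 𝕜).conjTranspose *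
            (!![t₁, 0; 0, t₂] * !![1, 0; c, 1]) := by
        rw [hg, Matrix.mul_assoc, Matrix.conjTranspose_mul k, Matrix.mul_assoc,
          ← Matrix.mul_assoc _ k, ← Matrix.star_eq_conjTranspose k, hkk, Matrix.one_mul]
      have e11 : (1 + ‖x‖ ^ 2 : ℝ) = ‖t₂‖ ^ 2 := by
        have := congrFun (congrFun key 1) 1
        simp [nu, Matrix.mul_apply, Fin.sum_univ_two, RCLike.conj_mul] at this
        have h' : ((‖x‖ ^ 2 + 1 : ℝ) : 𝕜) = ((‖t₂‖ ^ 2 : ℝ) : 𝕜) := by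
          push_cast; exact this
        have := RCLike.ofReal_injective h'
        linarith
      have edet : ‖t₁‖ * ‖t₂‖ = 1 := by
        have := congrArg Matrix.det key
        simp only [Matrix.det_mul, Matrix.det_conjTranspose] at this
        simp [nu, Matrix.det_fin_two] at this
        have h' := congrArg norm this
        simp only [norm_mul, norm_one, RCLike.norm_conj] at h'
        have h3 : (‖t₁‖ * ‖t₂‖) ^ 2 = 1 := by rw [h']; ring
        nlinarith [norm_nonneg t₁, norm_nonneg t₂, mul_nonneg (norm_nonneg t₁) (norm_nonneg t₂)]
      have h2' : ‖t₂‖ ≠ 0 := norm_ne_zero_iff.2 h2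
      have : ‖t₁ / t₂‖ = (1 + ‖x‖ ^ 2)⁻¹ := by
        rw [norm_div, e11, eq_inv_of_mul_eq_one_left edet]
        field_simp
      rw [vAbs, this]
    · rintro rfl
      set d : ℝ := Real.sqrt (1 + ‖x‖ ^ 2) with hd
      have hd0 : 0 < d := Real.sqrt_pos.2 hpos
      have hdd : d * d = 1 + ‖x‖ ^ 2 := Real.mul_self_sqrt hpos.le
      have hdk : (d : 𝕜) ≠ 0 := RCLike.ofReal_ne_zero.2 hd0.ne'
      have hddk : (d : 𝕜) * d = 1 + conj x * x := by
        rw [RCLike.conj_mul]; exact_mod_cast congrArg (RCLike.ofReal (K := 𝕜)) hdd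
      refine ⟨!![(d : 𝕜)⁻¹, x * (d : 𝕜)⁻¹; -conj x * (d : 𝕜)⁻¹, (d : 𝕜)⁻¹], ?_,
        (d : 𝕜)⁻¹, d, conj x * ((d : 𝕜)⁻¹ * (d : 𝕜)⁻¹), inv_ne_zero hdk, hdk, ?_, ?_⟩
      · rw [Matrix.mem_unitaryGroup_iff]
        ext i j
        fin_cases i <;> fin_cases j <;>
          simp [Matrix.mul_apply, Fin.sum_univ_two, Matrix.star_eq_conjTranspose] <;>
          field_simp <;>
          first | done | ring1 | linear_combination hddk | linear_combination -hddk
      · ext i j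
        fin_cases i <;> fin_cases j <;>
          simp [nu, Matrix.mul_apply, Fin.sum_univ_two] <;>
          field_simp <;>
          first | done | ring1 | linear_combination hddk | linear_combination -hddk
      · rw [vAbs, norm_div, norm_inv, RCLike.norm_ofReal, abs_of_pos hd0, ← hdd]
        congr 2
        field_simp
  rw [height, hset, csSup_singleton]

end Height

theorem RealPlace.height_nu (x : ℝ) : height (nu x) = (1 + x ^ 2) ^ (-(1 / 2) : ℝ) := by
  rw [ArchHankel.height_nu, Module.finrank_self, pow_one, Real.norm_eq_abs, sq_abs,
    Real.rpow_neg (by positivity), Real.inv_rpow (by positivity)]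

theorem ComplexPlace.height_nu (x : ℂ) : height (nu x) = (1 + ‖x‖ ^ 2)⁻¹ := by
  rw [ArchHankel.height_nu, Complex.finrank_real_complex, ← Real.sqrt_eq_rpow,
    Real.sqrt_sq (by positivity)]

theorem RealPlace.fourier_schwartz (f : 𝓢(ℝ, ℂ)) :
    RealPlace.fourier f =ᵐ[volume] fun x => ∫ u : ℝ, f u * RealPlace.psi (x * u) := by
  have hf : MemLp (f : ℝ → ℂ) 2 volume := f.memLp 2 volume
  have h1 : hf.toLp f = f.toLp 2 := rfl
  unfold RealPlace.fourier
  rw [dif_pos hf, h1, SchwartzMap.toLp_fourierInv_eq]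
  filter_upwards [SchwartzMap.coeFn_toLp (𝓕⁻ f) 2 volume] with x hx
  rw [hx, SchwartzMap.fourierInv_coe, Real.fourierInv_eq']
  refine integral_congr_ae (Filter.Eventually.of_forall fun u => ?_)
  simp only [RealPlace.psi, smul_eq_mul]
  rw [mul_comm]
  congr 2
  simp
  ring

theorem ComplexPlace.fourier_schwartz (f : 𝓢(ℂ, ℂ)) :
    ComplexPlace.fourier f =ᵐ[volume]
      fun x => ∫ u : ℂ, f u * ComplexPlace.psi (x * u) ∂ComplexPlace.selfDual := by
  have hf : MemLp (f : ℂ → ℂ) 2 volume := f.memLp 2 volume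
  have h1 : hf.toLp f = f.toLp 2 := rfl
  unfold ComplexPlace.fourier
  rw [dif_pos hf, h1, SchwartzMap.toLp_fourierInv_eq]
  have hq : Measure.QuasiMeasurePreserving (fun x : ℂ => 2 * conj x) volume volume := by
    refine ⟨by fun_prop, ?_⟩
    have h2 : (fun x : ℂ => 2 * conj x) =
        (fun x : ℂ => (2 : ℝ) • x) ∘ (Complex.conjLIE : ℂ → ℂ) := by
      ext x; simp
    rw [h2, ← Measure.map_map (by fun_prop) (by fun_prop),
      Complex.conjLIE.measurePreserving.map_eq,
      Measure.map_addHaar_smul volume (two_ne_zero)]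
    exact Measure.smul_absolutelyContinuous
  filter_upwards [hq.ae (SchwartzMap.coeFn_toLp (𝓕⁻ f) 2 volume)] with x hx
  rw [hx, SchwartzMap.fourierInv_coe, Real.fourierInv_eq', ComplexPlace.selfDual,
    integral_smul_measure]
  simp only [ENNReal.toReal_ofNat, Complex.real_smul, ofReal_ofNat]
  congr 1
  refine integral_congr_ae (Filter.Eventually.of_forall fun u => ?_)
  simp only [ComplexPlace.psi, smul_eq_mul]
  rw [mul_comm]
  congr 2
  simp [Complex.inner]
  ring

/-- A meromorphic continuation from a nonempty open set, normalised at its singularities, is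
unique. -/
theorem meromorphicContinuation_unique {g₁ g₂ : ℂ → ℂ} {U : Set ℂ} (hU : IsOpen U)
    (hne : U.Nonempty) (h₁ : MeromorphicNFOn g₁ Set.univ) (h₂ : MeromorphicNFOn g₂ Set.univ)
    (h : Set.EqOn g₁ g₂ U) : g₁ = g₂ := by
  obtain ⟨z₀, hz₀⟩ := hne
  have hm : MeromorphicOn (g₁ - g₂) Set.univ := fun z hz =>
    (h₁ hz).meromorphicAt.sub (h₂ hz).meromorphicAt
  have htop : meromorphicOrderAt (g₁ - g₂) z₀ = ⊤ := by
    rw [meromorphicOrderAt_eq_top_iff]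
    filter_upwards [nhdsWithin_le_nhds (hU.mem_nhds hz₀)] with z hz
    simp [h hz]
  funext z
  have hz : meromorphicOrderAt (g₁ - g₂) z = ⊤ := by
    by_contra hcon
    exact hm.meromorphicOrderAt_ne_top_of_isPreconnected isPreconnected_univ
      (Set.mem_univ z) (Set.mem_univ z₀) hcon htop
  rw [meromorphicOrderAt_eq_top_iff] at hz
  have he : g₁ =ᶠ[nhdsWithin z {z}ᶜ] g₂ := by
    filter_upwards [hz] with w hw
    exact sub_eq_zero.1 hw
  exact (((h₁ (Set.mem_univ z)).eventuallyEq_nhdsNE_iff_eventuallyEq_nhds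
    (h₂ (Set.mem_univ z))).1 he).eq_of_nhds

end ArchHankel

end

/-! The basic function is a Bessel integral. For Re s < 1/2, Fourier inversion identifies it with a
constant times ∫₀^∞ exp(-a(t + ‖u‖²/t)) t^w dt/t, where (a, w) is (π, 1/2 - s) over ℝ and (2π, 1 -
2s) over ℂ (`basicIntegral_eq`). For u ≠ 0 this integral is entire in w, so it also gives the
continuation in s (`basicFunction_eq`); the excluded point u = 0 is a null set.

For fixed t the integrand is a Gaussian in u. Let p be one of the monomials of the theorem. It is a
homogeneous harmonic polynomial of degree n, so the Fourier transform of p times a Gaussian is I ^ n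
p times a Gaussian, up to scaling (`FourierGaussian`). Integrating over t, the transform of p𝕃 is a
constant times p(y) (1 + ‖y‖²)^(-e), with e = 1 - s + n over ℝ and e = 2 - 2s + n over ℂ; over ℂ the
pairing ψ(xu) turns p(y) into p(conj y) (`fourierInv_bessel`).

Such a function behaves simply under inversion: (1 + ‖1/y‖²)^(-e) = ‖y‖^(2e) (1 + ‖y‖²)^(-e), and
since 1/y = conj y / ‖y‖², the power ‖y‖^(2e) is cancelled exactly by |y|_v^(2s-2) and the
homogeneity of p (`inversion_eq`). Over ℂ inversion also conjugates, so the result is the transform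
of the conjugate monomial times 𝕃. The second transform is then a reflection u ↦ -u, which produces
the sign (-1) ^ n.

The transform is defined on L² but computed as an absolutely convergent integral;
`fourier_of_integrable` links the two. Every estimate holds up to and including Re s = 1/2. -/

namespace ArchHankel

/-! ### Fourier integrals of integrable functions against the `L²` transform. -/

section L1L2

variable {E : Type*} [NormedAddCommGroup E] [InnerProductSpace ℝ E] [FiniteDimensional ℝ E]
  [MeasurableSpace E] [BorelSpace E]

theorem integral_schwartz_mul_fourier {h : E → ℂ} (hh : Integrable h) (φ : 𝓢(E, ℂ)) :
    ∫ x, φ x * 𝓕 h x = ∫ x, (𝓕 φ : 𝓢(E, ℂ)) x * h x := by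
  have := VectorFourier.integral_fourierIntegral_smul_eq_flip (L := innerₗ E) (μ := volume)
    (ν := volume) Real.continuous_fourierChar continuous_inner φ.integrable hh
  simpa using! this.symm

/-- Two locally integrable functions that agree against Schwartz functions agree a.e. -/
theorem ae_eq_of_integral_schwartz {f g : E → ℂ} (hf : LocallyIntegrable f)
    (hg : LocallyIntegrable g) (h : ∀ φ : 𝓢(E, ℂ), ∫ x, φ x * f x = ∫ x, φ x * g x) :
    f =ᵐ[volume] g := by
  refine ae_eq_of_integral_contDiff_smul_eq hf hg fun φ hφ hc => ?_
  have hc' : HasCompactSupport (fun x => (φ x : ℂ)) := hc.comp_left (g := Complex.ofReal) rfl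
  have hφ' : ContDiff ℝ ((⊤ : ℕ∞) : WithTop ℕ∞) (fun x => (φ x : ℂ)) := Complex.ofRealCLM.contDiff.comp hφ
  simpa using h (hc'.toSchwartzMap hφ')

/-- Square integrability of h need not be assumed: the `L²` inverse transform k of 𝓕 h has the same
pairings with Schwartz functions as h, because both transforms are moved onto the test function.
Hence h = k almost everywhere. -/
theorem exists_memLp_fourier_toLp {h : E → ℂ} (hh : Integrable h) (hg : MemLp (𝓕 h) 2 volume) :
    ∃ h2 : MemLp h 2 volume, (𝓕 (h2.toLp h) : Lp ℂ 2 (volume : Measure E)) = hg.toLp (𝓕 h) := by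
  set k : Lp ℂ 2 (volume : Measure E) := 𝓕⁻ (hg.toLp (𝓕 h)) with hk
  have hhk : h =ᵐ[volume] k := by
    refine ae_eq_of_integral_schwartz hh.locallyIntegrable
      ((Lp.memLp k).locallyIntegrable (by norm_num)) fun φ => ?_
    have h1 := DFunLike.congr_fun (Lp.fourierInv_toTemperedDistribution_eq (hg.toLp (𝓕 h))) φ
    rw [TemperedDistribution.fourierInv_apply, Lp.toTemperedDistribution_apply,
      Lp.toTemperedDistribution_apply] at h1
    simp only [smul_eq_mul] at h1
    rw [← hk] at h1
    rw [← h1]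
    have h2 : ∫ x, (𝓕⁻ φ : 𝓢(E, ℂ)) x * (hg.toLp (𝓕 h)) x = ∫ x, (𝓕⁻ φ : 𝓢(E, ℂ)) x * 𝓕 h x := by
      refine integral_congr_ae ?_
      filter_upwards [hg.coeFn_toLp] with x hx
      rw [hx]
    rw [h2, integral_schwartz_mul_fourier hh, FourierTransform.fourier_fourierInv_eq]
  have h2 : MemLp h 2 volume := (memLp_congr_ae hhk).2 (Lp.memLp k)
  refine ⟨h2, ?_⟩
  have : h2.toLp h = k := by
    apply Lp.ext
    exact h2.coeFn_toLp.trans hhk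
  rw [this, hk, FourierTransform.fourier_fourierInv_eq]

theorem exists_memLp_fourierInv_toLp {h : E → ℂ} (hh : Integrable h)
    (hg : MemLp (𝓕⁻ h) 2 volume) :
    ∃ h2 : MemLp h 2 volume,
      (𝓕⁻ (h2.toLp h) : Lp ℂ 2 (volume : Measure E)) = hg.toLp (𝓕⁻ h) := by
  set k : Lp ℂ 2 (volume : Measure E) := 𝓕 (hg.toLp (𝓕⁻ h)) with hk
  have hhk : h =ᵐ[volume] k := by
    refine ae_eq_of_integral_schwartz hh.locallyIntegrable
      ((Lp.memLp k).locallyIntegrable (by norm_num)) fun φ => ?_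
    have h1 := DFunLike.congr_fun (Lp.fourier_toTemperedDistribution_eq (hg.toLp (𝓕⁻ h))) φ
    rw [TemperedDistribution.fourier_apply, Lp.toTemperedDistribution_apply,
      Lp.toTemperedDistribution_apply] at h1
    simp only [smul_eq_mul] at h1
    rw [← hk] at h1
    rw [← h1]
    have h2 : ∫ x, (𝓕 φ : 𝓢(E, ℂ)) x * (hg.toLp (𝓕⁻ h)) x = ∫ x, (𝓕 φ : 𝓢(E, ℂ)) x * 𝓕⁻ h x := by
      refine integral_congr_ae ?_
      filter_upwards [hg.coeFn_toLp] with x hx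
      rw [hx]
    -- The pairing identity is available for 𝓕 only, so 𝓕⁻ h is read as 𝓕 of the reflection of h;
    -- the reflection is then undone by 𝓕 (𝓕 φ) (-x) = φ x.
    rw [h2, Real.fourierInv_eq_fourier_comp_neg, integral_schwartz_mul_fourier hh.comp_neg,
      ← integral_neg_eq_self (fun x => (𝓕 (𝓕 φ) : 𝓢(E, ℂ)) x * h (-x))]
    refine integral_congr_ae (Filter.Eventually.of_forall fun x => ?_)
    have h3 : (𝓕 (𝓕 φ) : 𝓢(E, ℂ)) (-x) = φ x := by
      rw [SchwartzMap.fourier_coe, ← Real.fourierInv_eq_fourier_neg, ← SchwartzMap.fourierInv_coe,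
        FourierTransform.fourierInv_fourier_eq]
    simp only [neg_neg]
    rw [h3]
  have h2 : MemLp h 2 volume := (memLp_congr_ae hhk).2 (Lp.memLp k)
  refine ⟨h2, ?_⟩
  have : h2.toLp h = k := by
    apply Lp.ext
    exact h2.coeFn_toLp.trans hhk
  rw [this, hk, FourierTransform.fourierInv_fourier_eq]

end L1L2

/-! ### The `L²` transforms on integrable functions -/

theorem quasiMeasurePreserving_two_mul_conj :
    Measure.QuasiMeasurePreserving (fun x : ℂ => 2 * conj x) volume volume := by
  refine ⟨by fun_prop, ?_⟩
  have h2 : (fun x : ℂ => 2 * conj x) =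
      (fun x : ℂ => (2 : ℝ) • x) ∘ (Complex.conjLIE : ℂ → ℂ) := by
    ext x; simp
  rw [h2, ← Measure.map_map (by fun_prop) (by fun_prop),
    Complex.conjLIE.measurePreserving.map_eq, Measure.map_addHaar_smul volume (two_ne_zero)]
  exact Measure.smul_absolutelyContinuous

theorem memLp_comp_real_smul_conj {f : ℂ → ℂ} {c : ℝ} (hc : c ≠ 0) (hf : MemLp f 2 volume) :
    MemLp (fun x : ℂ => f (c • conj x)) 2 volume := by
  have h1 : MemLp (fun x => f (c • x)) 2 volume := by
    have : MemLp f 2 (Measure.map (fun x : ℂ => c • x) volume) := by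
      rw [Measure.map_addHaar_smul volume hc]
      exact hf.smul_measure ENNReal.ofReal_ne_top
    exact this.comp_of_map (by fun_prop)
  exact h1.comp_measurePreserving Complex.conjLIE.measurePreserving

theorem integral_comp_two_mul_conj (f : ℂ → ℂ) :
    ∫ x : ℂ, f (2 * conj x) = (1 / 4) * ∫ x, f x := by
  have h1 := Complex.conjLIE.measurePreserving.integral_comp
    Complex.conjLIE.toHomeomorph.measurableEmbedding (fun x => f ((2 : ℝ) • x))
  have h2 := Measure.integral_comp_smul (volume : Measure ℂ) f 2
  rw [h2] at h1
  simp only [conjLIE_apply, real_smul, ofReal_ofNat, finrank_real_complex] at h1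
  rw [h1, abs_of_pos (by positivity)]
  norm_num

theorem RealPlace.fourier_congr {f g : ℝ → ℂ} (h : f =ᵐ[volume] g) :
    RealPlace.fourier f = RealPlace.fourier g := by
  unfold RealPlace.fourier
  by_cases hf : MemLp f 2 volume
  · have hg := (memLp_congr_ae h).1 hf
    rw [dif_pos hf, dif_pos hg, (MemLp.toLp_eq_toLp_iff hf hg).2 h]
  · rw [dif_neg hf, dif_neg (fun hg => hf ((memLp_congr_ae h).2 hg))]

theorem ComplexPlace.fourier_congr {f g : ℂ → ℂ} (h : f =ᵐ[volume] g) :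
    ComplexPlace.fourier f = ComplexPlace.fourier g := by
  unfold ComplexPlace.fourier
  by_cases hf : MemLp f 2 volume
  · have hg := (memLp_congr_ae h).1 hf
    rw [dif_pos hf, dif_pos hg, (MemLp.toLp_eq_toLp_iff hf hg).2 h]
  · rw [dif_neg hf, dif_neg (fun hg => hf ((memLp_congr_ae h).2 hg))]

/-- An integrable function with square integrable Fourier integral is square integrable, its `L²`
transform is the Fourier integral, and transforming twice is reflection. -/
theorem RealPlace.fourier_of_integrable {h : ℝ → ℂ} (hh : Integrable h)
    (hg : MemLp (𝓕⁻ h) 2 volume) :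
    MemLp h 2 volume ∧ RealPlace.fourier h =ᵐ[volume] 𝓕⁻ h ∧
      RealPlace.fourier (𝓕⁻ h) =ᵐ[volume] fun x => h (-x) := by
  obtain ⟨h2, e2⟩ := exists_memLp_fourierInv_toLp hh hg
  refine ⟨h2, ?_, ?_⟩
  · unfold RealPlace.fourier
    rw [dif_pos h2, e2]
    exact hg.coeFn_toLp
  · have hneg : 𝓕⁻ h = 𝓕 fun x => h (-x) := Real.fourierInv_eq_fourier_comp_neg h
    rw [hneg] at hg ⊢
    obtain ⟨h3, e3⟩ := exists_memLp_fourier_toLp hh.comp_neg hg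
    unfold RealPlace.fourier
    rw [dif_pos hg, ← e3, FourierTransform.fourierInv_fourier_eq]
    exact h3.coeFn_toLp

theorem ComplexPlace.fourier_of_integrable {h : ℂ → ℂ} (hh : Integrable h)
    (hg : MemLp (fun x => 2 * 𝓕⁻ h (2 * conj x)) 2 volume) :
    MemLp h 2 volume ∧
      ComplexPlace.fourier h =ᵐ[volume] (fun x => 2 * 𝓕⁻ h (2 * conj x)) ∧
      ComplexPlace.fourier (fun x => 2 * 𝓕⁻ h (2 * conj x)) =ᵐ[volume] fun x => h (-x) := by
  have hscale : MemLp (𝓕⁻ h) 2 volume := by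
    refine (memLp_congr_ae (Filter.Eventually.of_forall fun x => ?_)).1
      ((memLp_comp_real_smul_conj (c := 1 / 2) (by norm_num) hg).const_mul (1 / 2))
    have h2 : 2 * conj ((1 / 2 : ℝ) • conj x) = x := by
      rw [real_smul, map_mul, conj_conj, conj_ofReal]
      push_cast
      ring
    simp only [h2]
    ring
  obtain ⟨h2, e2⟩ := exists_memLp_fourierInv_toLp hh hscale
  refine ⟨h2, ?_, ?_⟩
  · unfold ComplexPlace.fourier
    rw [dif_pos h2, e2]
    filter_upwards [quasiMeasurePreserving_two_mul_conj.ae hscale.coeFn_toLp] with x hx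
    rw [hx]
  -- The function k is h pulled back by the inverse of v ↦ -2 conj v, scaled so that the self-dual
  -- transform of h becomes 𝓕 k; the Jacobian 1/4 turns the factor 2 into 1/2. Then 𝓕⁻ undoes 𝓕 in
  -- `L²`.
  · set k : ℂ → ℂ := fun v => (1 / 2) * h (-(conj v) / 2) with hk
    have hneg : (fun x => 2 * 𝓕⁻ h (2 * conj x)) = 𝓕 k := by
      ext x
      rw [Real.fourier_eq', Real.fourierInv_eq']
      have h1 := integral_comp_two_mul_conj
        fun v => cexp (↑(-2 * π * inner ℝ v x) * I) • k v
      have h2 : ∫ u : ℂ, cexp (↑(-2 * π * inner ℝ (2 * conj u) x) * I) • k (2 * conj u) =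
          (1 / 2) * ∫ u : ℂ, cexp (↑(2 * π * inner ℝ u (2 * conj x)) * I) • h u := by
        rw [← integral_const_mul, ← integral_neg_eq_self]
        refine integral_congr_ae (Filter.Eventually.of_forall fun u => ?_)
        simp only [hk, map_neg, mul_neg, map_mul, conj_conj, neg_neg, smul_eq_mul, map_ofNat]
        rw [mul_div_cancel_left₀ _ (two_ne_zero), mul_left_comm]
        congr 3
        simp [Complex.inner]
        ring
      rw [h2] at h1
      linear_combination 4 * h1
    have hki : Integrable k := by
      have h1 := (hh.comp_smul (R := -1 / 2) (by norm_num)).const_mul (1 / 2)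
      refine ((Complex.conjLIE.measurePreserving.integrable_comp_emb
        Complex.conjLIE.toHomeomorph.measurableEmbedding).2 h1).congr
        (Filter.Eventually.of_forall fun x => ?_)
      simp [hk]
      ring_nf
    rw [hneg] at hg ⊢
    obtain ⟨h3, e3⟩ := exists_memLp_fourier_toLp hki hg
    unfold ComplexPlace.fourier
    rw [dif_pos hg, ← e3, FourierTransform.fourierInv_fourier_eq]
    filter_upwards [quasiMeasurePreserving_two_mul_conj.ae h3.coeFn_toLp] with x hx
    have h4 : -conj (2 * conj x) / 2 = -x := by
      rw [map_mul, conj_conj, map_ofNat]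
      ring
    rw [hx, hk]
    simp only [h4]
    ring

/-! ### Fourier transforms of Gaussians times harmonic polynomials. -/

section Gaussian

variable {V : Type*} [NormedAddCommGroup V] [InnerProductSpace ℝ V] [FiniteDimensional ℝ V]
  [MeasurableSpace V] [BorelSpace V]

theorem integrable_norm_pow_mul_gaussian (n : ℕ) {b : ℝ} (hb : 0 < b) :
    Integrable (fun v : V => ‖v‖ ^ n * Real.exp (-b * ‖v‖ ^ 2)) := by
  have h1 : Integrable (fun v : V => Real.exp (-(b / 2) * ‖v‖ ^ 2)) := by
    have := (GaussianFourier.integrable_cexp_neg_mul_sq_norm_add (V := V) (b := ((b / 2 : ℝ) : ℂ))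
      (by rw [ofReal_re]; positivity) 0 0).norm
    refine this.congr (Filter.Eventually.of_forall fun v => ?_)
    simp only [Complex.norm_exp]
    congr 1
    rw [zero_mul, add_zero, ← ofReal_pow, ← ofReal_neg, ← ofReal_mul, ofReal_re]
  refine (h1.const_mul (n.factorial * Real.exp (1 / (2 * b)))).mono'
    (by fun_prop) (Filter.Eventually.of_forall fun v => ?_)
  rw [Real.norm_of_nonneg (by positivity)]
  have h2 : ‖v‖ ^ n ≤ n.factorial * Real.exp ‖v‖ := by
    have := Real.pow_div_factorial_le_exp ‖v‖ (norm_nonneg v) n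
    rwa [div_le_iff₀' (by positivity)] at this
  -- Half of the Gaussian decay absorbs the exponential that dominates ‖v‖ ^ n; the constant comes
  -- from completing the square.
  have h3 : ‖v‖ + -b * ‖v‖ ^ 2 ≤ 1 / (2 * b) + -(b / 2) * ‖v‖ ^ 2 := by
    have : 1 / (2 * b) + -(b / 2) * ‖v‖ ^ 2 - (‖v‖ + -b * ‖v‖ ^ 2) =
        (b * ‖v‖ - 1) ^ 2 / (2 * b) := by field_simp; ring
    have h4 : 0 ≤ (b * ‖v‖ - 1) ^ 2 / (2 * b) := by positivity
    linarith
  calc ‖v‖ ^ n * Real.exp (-b * ‖v‖ ^ 2)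
      ≤ n.factorial * Real.exp ‖v‖ * Real.exp (-b * ‖v‖ ^ 2) := by gcongr
    _ = n.factorial * Real.exp (‖v‖ + -b * ‖v‖ ^ 2) := by rw [Real.exp_add]; ring
    _ ≤ n.factorial * Real.exp (1 / (2 * b) + -(b / 2) * ‖v‖ ^ 2) := by gcongr
    _ = _ := by rw [Real.exp_add]; ring

/-- `p` is a homogeneous function of degree `n` for which Gaussians times `p` have
the Fourier transform known for harmonic polynomials. -/
structure FourierGaussian (p : V → ℂ) (n : ℕ) : Prop where
  continuous : Continuous p
  norm_eq (v : V) : ‖p v‖ = ‖v‖ ^ n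
  fourierInv_eq {b : ℝ} (hb : 0 < b) (y : V) :
    𝓕⁻ (fun v => p v * (Real.exp (-b * ‖v‖ ^ 2) : ℂ)) y =
      I ^ n * (((π / b) ^ (Module.finrank ℝ V / 2 + n : ℝ) : ℝ) : ℂ) *
        (p y * (Real.exp (-(π ^ 2 / b) * ‖y‖ ^ 2) : ℂ))

theorem fourier_gaussian_real_param {b : ℝ} (hb : 0 < b) (y : V) :
    𝓕 (fun v : V => (Real.exp (-b * ‖v‖ ^ 2) : ℂ)) y =
      (((π / b) ^ (Module.finrank ℝ V / 2 : ℝ) : ℝ) : ℂ) *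
        (Real.exp (-(π ^ 2 / b) * ‖y‖ ^ 2) : ℂ) := by
  have := fourier_gaussian_innerProductSpace (V := V) (b := (b : ℂ)) (by simpa using hb) y
  rw [ofReal_cpow (by positivity)]
  push_cast
  rw [this]
  congr 2
  ring

theorem fourierGaussian_one : FourierGaussian (fun _ : V => (1 : ℂ)) 0 where
  continuous := continuous_const
  norm_eq v := by simp
  fourierInv_eq hb y := by
    simp only [one_mul, Real.fourierInv_eq_fourier_neg, pow_zero]
    rw [fourier_gaussian_real_param hb, norm_neg]
    simp

end Gaussian

theorem hasDerivAt_gaussian_line {V : Type*} [NormedAddCommGroup V] [InnerProductSpace ℝ V]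
    (β : ℝ) (y v : V) :
    HasDerivAt (fun t : ℝ => (Real.exp (-β * ‖y + t • v‖ ^ 2) : ℂ))
      ((-2 * β * inner ℝ y v : ℝ) * (Real.exp (-β * ‖y‖ ^ 2) : ℂ)) 0 := by
  have h1 : HasDerivAt (fun t : ℝ => y + t • v) v 0 := by
    simpa using ((hasDerivAt_id (0 : ℝ)).smul_const v).const_add y
  have h2 := ((h1.norm_sq.const_mul (-β)).exp).ofReal_comp
  convert! h2 using 1
  simp
  ring

theorem inner_one_add_I_mul_inner_I (y : ℂ) : (inner ℝ y 1 : ℝ) + I * (inner ℝ y I : ℝ) = y := by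
  apply Complex.ext <;> simp [Complex.inner]

/-- Induction on n: multiplying by u amounts to applying ∂₁ + I ∂_I to the transform. This operator
kills the holomorphic factor y ^ n, so only the Gaussian is differentiated, and that brings down one
more factor y. -/
theorem fourier_pow_mul_gaussian (n : ℕ) {b : ℝ} (hb : 0 < b) (y : ℂ) :
    𝓕 (fun v : ℂ => v ^ n * (Real.exp (-b * ‖v‖ ^ 2) : ℂ)) y =
      (-I) ^ n * (((π / b) ^ (n + 1) : ℝ) : ℂ) *
        (y ^ n * (Real.exp (-(π ^ 2 / b) * ‖y‖ ^ 2) : ℂ)) := by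
  induction n generalizing y with
  | zero =>
    simp only [pow_zero, one_mul]
    rw [fourier_gaussian_real_param hb, finrank_real_complex]
    norm_num
  | succ n ih =>
    set f : ℂ → ℂ := fun v => v ^ n * (Real.exp (-b * ‖v‖ ^ 2) : ℂ) with hf
    have hnorm (v : ℂ) : ‖f v‖ = ‖v‖ ^ n * Real.exp (-b * ‖v‖ ^ 2) := by
      rw [hf, norm_mul, norm_pow, Complex.norm_real, Real.norm_of_nonneg (by positivity)]
    have hfc : Continuous f := by fun_prop
    have hi : Integrable f :=
      (integrable_norm_iff hfc.aestronglyMeasurable).1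
        ((integrable_norm_pow_mul_gaussian n hb).congr
          (Filter.Eventually.of_forall fun v => (hnorm v).symm))
    have hi' : Integrable (fun v => ‖v‖ * ‖f v‖) :=
      (integrable_norm_pow_mul_gaussian (n + 1) hb).congr
          (Filter.Eventually.of_forall fun v => by simp only [hnorm]; ring)
    have hD := Real.hasFDerivAt_fourier hi hi' y
    set D := 𝓕 (VectorFourier.fourierSMulRight (innerSL ℝ) f) y with hDdef
    have hDi : Integrable (VectorFourier.fourierSMulRight (innerSL ℝ) f) := by
      refine (hi'.const_mul (2 * π * ‖(innerSL ℝ : ℂ →L[ℝ] ℂ →L[ℝ] ℝ)‖)).mono'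
        ?_ (Filter.Eventually.of_forall fun v => ?_)
      · exact hi.1.fourierSMulRight
      · have := VectorFourier.norm_fourierSMulRight_le (innerSL ℝ : ℂ →L[ℝ] ℂ →L[ℝ] ℝ) f v
        linarith
    have hDapp (v : ℂ) : D v = 𝓕 (fun u => -(2 * π * I) * ((inner ℝ u v : ℝ) * f u)) y := by
      rw [hDdef, Real.fourier_continuousLinearMap_apply hDi]
      rfl
    have hDint (v : ℂ) : Integrable (fun u => -(2 * π * I) * ((inner ℝ u v : ℝ) * f u)) := by
      refine (hDi.apply_continuousLinearMap v).congr (Filter.Eventually.of_forall fun u => ?_)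
      rfl
    have hsum : D 1 + I * D I = -(2 * π * I) * 𝓕 (fun u => u * f u) y := by
      rw [hDapp, hDapp]
      simp only [Real.fourier_eq]
      rw [← integral_const_mul, ← integral_const_mul, ← integral_add]
      · refine integral_congr_ae (Filter.Eventually.of_forall fun u => ?_)
        simp only [Circle.smul_def, smul_eq_mul]
        linear_combination (-(2 * π * I) * f u * (𝐞 (-inner ℝ u y) : ℂ)) * inner_one_add_I_mul_inner_I u
      · exact (Real.fourierIntegral_convergent_iff y).2 (hDint 1)
      · exact ((Real.fourierIntegral_convergent_iff y).2 (hDint I)).const_mul I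
    have hline (v : ℂ) : D v = (-I) ^ n * (((π / b) ^ (n + 1) : ℝ) : ℂ) *
        (n * y ^ (n - 1) * v * (Real.exp (-(π ^ 2 / b) * ‖y‖ ^ 2) : ℂ) +
        y ^ n * ((-2 * (π ^ 2 / b) * inner ℝ y v : ℝ) *
          (Real.exp (-(π ^ 2 / b) * ‖y‖ ^ 2) : ℂ))) := by
      have h1 := hD.hasLineDerivAt v
      rw [HasLineDerivAt, funext ih] at h1
      have h2 : HasDerivAt (fun t : ℝ => y + t • v) v 0 := by
        simpa using ((hasDerivAt_id (0 : ℝ)).smul_const v).const_add y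
      have h3 := (((h2.pow n).mul (hasDerivAt_gaussian_line (π ^ 2 / b) y v)).const_mul
        ((-I) ^ n * (((π / b) ^ (n + 1) : ℝ) : ℂ)))
      have h4 := h1.unique h3
      rw [h4]
      simp
    have hfin : (fun v : ℂ => v ^ (n + 1) * (Real.exp (-b * ‖v‖ ^ 2) : ℂ)) = fun u => u * f u := by
      ext u; simp only [hf]; ring
    rw [hfin]
    rw [hline, hline] at hsum
    have hpi : (-(2 * π * I) : ℂ) ≠ 0 := by simp [Real.pi_ne_zero]
    apply mul_left_cancel₀ hpi
    rw [← hsum]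
    have hy := inner_one_add_I_mul_inner_I y
    push_cast
    set e := cexp (-(↑π ^ 2 / ↑b) * ↑‖y‖ ^ 2)
    rw [pow_succ (-I) n, pow_succ y n, pow_succ (π / b : ℂ) (n + 1)]
    have hI := I_mul_I
    -- The terms containing n * y ^ (n - 1) cancel because 1 + I * I = 0; this is the Cauchy–Riemann
    -- equation for y ^ n.
    trans (-I) ^ n * (π / b : ℂ) ^ (n + 1) * (y ^ n * e) * (-2 * (π ^ 2 / b)) * y
    · linear_combination
        (-I) ^ n * (π / b : ℂ) ^ (n + 1) * (n * y ^ (n - 1) * e) * hI +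
          (-I) ^ n * (π / b : ℂ) ^ (n + 1) * (y ^ n * e) * (-2 * (π ^ 2 / b)) * hy
    · linear_combination
        -(2 * π * (π / b : ℂ) * ((-I) ^ n * (π / b : ℂ) ^ (n + 1) * (y ^ n * y * e))) * hI

theorem fourierGaussian_pow (n : ℕ) : FourierGaussian (fun v : ℂ => v ^ n) n where
  continuous := by fun_prop
  norm_eq v := norm_pow _ _
  fourierInv_eq hb y := by
    rw [Real.fourierInv_eq_fourier_neg, fourier_pow_mul_gaussian n hb, finrank_real_complex,
      norm_neg, neg_pow I, neg_pow y, ← Real.rpow_natCast]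
    have h1 : ((-1 : ℂ) ^ n) * (-1) ^ n = 1 := by rw [← mul_pow]; simp
    have h2 : (((2 : ℕ) : ℝ) / 2 + n : ℝ) = ((n + 1 : ℕ) : ℝ) := by push_cast; ring
    rw [h2]
    linear_combination (I ^ n * (((π / _) ^ ((n + 1 : ℕ) : ℝ) : ℝ) : ℂ) *
        (y ^ n * (Real.exp (-(π ^ 2 / _) * ‖y‖ ^ 2) : ℂ))) * h1

theorem fourierGaussian_conj_pow (n : ℕ) : FourierGaussian (fun v : ℂ => conj v ^ n) n where
  continuous := by fun_prop
  norm_eq v := by simp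
  fourierInv_eq {b} hb y := by
    have h1 := Real.fourierInv_comp_linearIsometry Complex.conjLIE
      (fun v : ℂ => v ^ n * (Real.exp (-b * ‖v‖ ^ 2) : ℂ)) y
    rw [(fourierGaussian_pow n).fourierInv_eq hb] at h1
    simpa [Function.comp_def] using h1

theorem fourierGaussian_real {n : ℕ} (hn : n ≤ 1) : FourierGaussian (fun v : ℝ => (v : ℂ) ^ n) n := by
  interval_cases n
  · simpa using fourierGaussian_one (V := ℝ)
  · refine ⟨by fun_prop, fun v => by simp, fun {b} hb y => ?_⟩
    set f : ℝ → ℂ := fun v => (Real.exp (-b * ‖v‖ ^ 2) : ℂ) with hf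
    have hi : Integrable f := by
      have := (integrable_norm_pow_mul_gaussian (V := ℝ) 0 hb)
      simp only [pow_zero, one_mul] at this
      exact this.ofReal
    have hi' : Integrable (fun v : ℝ => v • f v) := by
      refine ((integrable_norm_pow_mul_gaussian (V := ℝ) 1 hb)).mono' ?_ ?_
      · have : Continuous (fun v : ℝ => v • f v) := by fun_prop
        exact this.aestronglyMeasurable
      · refine Filter.Eventually.of_forall fun v => ?_
        rw [norm_smul, hf, Complex.norm_real, Real.norm_of_nonneg (Real.exp_pos _).le, pow_one]
    -- Multiplication by v is differentiation of the transform, so the case n = 1 follows by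
    -- computing the derivative of the transformed Gaussian at -y in two ways.
    have h1 := Real.hasDerivAt_fourier hi hi' (-y)
    have h3 := ((hasDerivAt_gaussian_line (π ^ 2 / b) (-y) (1 : ℝ)).const_mul
        ((((π / b) ^ (Module.finrank ℝ ℝ / 2 : ℝ) : ℝ) : ℂ)))
    rw [hf, funext (fourier_gaussian_real_param (V := ℝ) hb)] at h1
    have h4 : HasDerivAt (fun t : ℝ => -y + t • (1 : ℝ)) 1 0 := by
      simpa using ((hasDerivAt_id (0 : ℝ)).smul_const (1 : ℝ)).const_add (-y)
    rw [show -y = -y + (0 : ℝ) • (1 : ℝ) by simp] at h1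
    have h5 := (h1.scomp_of_eq (0 : ℝ) h4 rfl).unique h3
    simp only [zero_smul, add_zero, one_smul] at h5
    rw [Real.fourierInv_eq_fourier_neg]
    have h6 : 𝓕 (fun x : ℝ => (-2 * π * I * x : ℂ) • (Real.exp (-b * ‖x‖ ^ 2) : ℂ)) (-y) =
        (-2 * π * I) * 𝓕 (fun v : ℝ => (v : ℂ) ^ 1 * (Real.exp (-b * ‖v‖ ^ 2) : ℂ)) (-y) := by
      simp only [Real.fourier_eq]
      rw [← integral_const_mul]
      refine integral_congr_ae (Filter.Eventually.of_forall fun u => ?_)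
      simp only [Circle.smul_def, smul_eq_mul]
      ring
    rw [h6] at h5
    have hpi : (-2 * π * I : ℂ) ≠ 0 := by simp [Real.pi_ne_zero]
    apply mul_left_cancel₀ hpi
    rw [h5, norm_neg, Nat.cast_one, Real.rpow_add (by positivity), Real.rpow_one]
    simp only [RCLike.inner_apply]
    push_cast
    simp only [Module.finrank_self, conj_trivial, Nat.cast_one, ofReal_neg]
    linear_combination (2 * π * (π / b : ℂ) * (((π / b : ℝ) ^ (1 / 2 : ℝ) : ℝ) : ℂ) * y *
      cexp (-(π ^ 2 / b) * ((‖y‖ : ℝ) : ℂ) ^ 2)) * I_mul_I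

/-! ### The Bessel integral -/

/-- The Bessel integral `∫₀^∞ exp(-a (t + r / t)) t ^ w dt / t`. -/
noncomputable def besselIntegral (a r : ℝ) (w : ℂ) : ℂ :=
  ∫ t in Set.Ioi (0 : ℝ), (t : ℂ) ^ (w - 1) * (Real.exp (-(a * t) - a * r / t) : ℂ)

/-- This is a Mellin transform of a function that decays exponentially at infinity and, because r >
0, faster than any power at 0. Hence there is no restriction on w. -/
theorem differentiable_besselIntegral {a r : ℝ} (ha : 0 < a) (hr : 0 < r) :
    Differentiable ℂ (besselIntegral a r) := by
  intro w
  set f : ℝ → ℂ := fun t => (Real.exp (-(a * t) - a * r / t) : ℂ) with hf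
  have hcont : ContinuousOn f (Set.Ioi 0) := by
    rw [hf]
    refine continuous_ofReal.comp_continuousOn (Real.continuous_exp.comp_continuousOn ?_)
    refine ContinuousOn.sub (by fun_prop) (ContinuousOn.div (by fun_prop) (by fun_prop) ?_)
    intro t ht
    exact (ne_of_gt ht)
  have hnorm (t : ℝ) : ‖f t‖ = Real.exp (-(a * t) - a * r / t) := by
    rw [hf, Complex.norm_real, Real.norm_of_nonneg (Real.exp_pos _).le]
  have htop : f =O[Filter.atTop] fun t => Real.exp (-a * t) := by
    refine Asymptotics.IsBigO.of_bound 1 ?_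
    filter_upwards [Filter.eventually_gt_atTop 0] with t ht
    rw [hnorm, Real.norm_of_nonneg (Real.exp_pos _).le, one_mul]
    have : 0 < a * r / t := by positivity
    exact Real.exp_le_exp.2 (by linarith)
  have hbot : f =O[nhdsWithin 0 (Set.Ioi 0)] fun t => t ^ (-(w.re - 1)) := by
    have h1 := ((isLittleO_exp_neg_mul_rpow_atTop (mul_pos ha hr) (w.re - 1)).isBigO).comp_tendsto
      tendsto_inv_nhdsGT_zero
    refine Asymptotics.IsBigO.trans (Asymptotics.IsBigO.of_bound 1 ?_) (h1.trans ?_)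
    · filter_upwards [self_mem_nhdsWithin] with t ht
      have ht : 0 < t := ht
      rw [hnorm, Function.comp, Real.norm_of_nonneg (Real.exp_pos _).le, one_mul]
      have : 0 < a * t := by positivity
      refine Real.exp_le_exp.2 ?_
      rw [div_eq_mul_inv]
      linarith
    · refine Filter.EventuallyEq.isBigO ?_
      filter_upwards [self_mem_nhdsWithin] with t ht
      have ht : 0 < t := ht
      rw [Function.comp, Real.inv_rpow ht.le, Real.rpow_neg ht.le]
  exact mellin_differentiableAt_of_isBigO_rpow_exp ha
    (hcont.locallyIntegrableOn measurableSet_Ioi) htop hbot (by linarith)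

theorem integrableOn_rpow_mul_exp {a c : ℝ} (ha : 0 < a) (hc : 0 < c) :
    IntegrableOn (fun t : ℝ => t ^ (c - 1) * Real.exp (-(a * t))) (Set.Ioi 0) := by
  have := integrableOn_rpow_mul_exp_neg_mul_rpow (p := 1) (s := c - 1) (b := a)
    (by linarith) one_pos ha
  simpa using this

/-- For Re w > 0 the integrand is dominated by its value at v = 0, which is integrable. Continuity
at v = 0 is what pointwise Fourier inversion needs. -/
theorem continuous_besselIntegral_norm_sq {V : Type*} [NormedAddCommGroup V]
    {a : ℝ} (ha : 0 < a) {w : ℂ} (hw : 0 < w.re) :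
    Continuous fun v : V => besselIntegral a (‖v‖ ^ 2) w := by
  refine continuous_of_dominated (bound := fun t => t ^ (w.re - 1) * Real.exp (-(a * t)))
    (fun v => ?_) (fun v => ?_) (integrableOn_rpow_mul_exp ha hw) ?_
  · exact Measurable.aestronglyMeasurable (by fun_prop)
  · filter_upwards [ae_restrict_mem measurableSet_Ioi] with t ht
    have ht : 0 < t := ht
    rw [norm_mul, norm_cpow_eq_rpow_re_of_pos ht, Complex.norm_real,
      Real.norm_of_nonneg (Real.exp_pos _).le, sub_re, one_re]
    have : 0 ≤ a * ‖v‖ ^ 2 / t := by positivity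
    gcongr
    linarith
  · exact Filter.Eventually.of_forall fun t => by fun_prop

/-- The integrand of `p v * besselIntegral a (‖v‖ ^ 2) w`. -/
noncomputable def besselKernel {V : Type*} [NormedAddCommGroup V] (p : V → ℂ) (a : ℝ) (w : ℂ)
    (x : V × ℝ) : ℂ :=
  p x.1 * ((x.2 : ℂ) ^ (w - 1) * (Real.exp (-(a * x.2) - a * ‖x.1‖ ^ 2 / x.2) : ℂ))

theorem mul_besselIntegral {V : Type*} [NormedAddCommGroup V] (p : V → ℂ) (a : ℝ) (w : ℂ)
    (v : V) :
    p v * besselIntegral a (‖v‖ ^ 2) w = ∫ t in Set.Ioi (0 : ℝ), besselKernel p a w (v, t) := by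
  rw [besselIntegral, ← integral_const_mul]
  rfl

/-! ### The Fourier transform of a Bessel integral. -/

section Fourier

variable {V : Type*} [NormedAddCommGroup V] [InnerProductSpace ℝ V] [FiniteDimensional ℝ V]
  [MeasurableSpace V] [BorelSpace V]

theorem integral_norm_pow_mul_gaussian (n : ℕ) {b : ℝ} (hb : 0 < b) :
    ∫ v : V, ‖v‖ ^ n * Real.exp (-b * ‖v‖ ^ 2) =
      b⁻¹ ^ ((Module.finrank ℝ V + n : ℝ) / 2) *
        ∫ v : V, ‖v‖ ^ n * Real.exp (-1 * ‖v‖ ^ 2) := by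
  have h1 := Measure.integral_comp_smul (volume : Measure V)
    (fun v => ‖v‖ ^ n * Real.exp (-1 * ‖v‖ ^ 2)) (√b)
  have hs : 0 < √b := Real.sqrt_pos.2 hb
  have h2 : ∀ v : V, ‖√b • v‖ ^ n * Real.exp (-1 * ‖√b • v‖ ^ 2) =
      √b ^ n * (‖v‖ ^ n * Real.exp (-b * ‖v‖ ^ 2)) := fun v => by
    rw [norm_smul, Real.norm_of_nonneg hs.le, mul_pow, mul_pow, Real.sq_sqrt hb.le]
    ring_nf
  simp only [h2] at h1
  rw [integral_const_mul, abs_of_pos (by positivity), smul_eq_mul] at h1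
  have h3 : b⁻¹ ^ ((Module.finrank ℝ V + n : ℝ) / 2) =
      (√b ^ n)⁻¹ * (√b ^ (Module.finrank ℝ V))⁻¹ := by
    rw [← Nat.cast_add, Real.inv_rpow hb.le, Real.rpow_div_two_eq_sqrt _ hb.le,
      Real.rpow_natCast, pow_add, mul_inv, mul_comm]
  rw [h3, mul_assoc, ← h1]
  field_simp

theorem exp_bessel_eq (a t r : ℝ) : Real.exp (-(a * t) - a * r / t) =
    Real.exp (-(a * t)) * Real.exp (-(a / t) * r) := by
  rw [← Real.exp_add]
  ring_nf

namespace FourierGaussian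

variable {p : V → ℂ} {n : ℕ}

/-- Integrating in v first gains a factor t ^ ((d + n) / 2), with d the dimension, and leaves a
Gamma integral. So Re w = 0, which is the line Re s = 1/2, is allowed. -/
theorem integrable_besselKernel (hp : FourierGaussian p n) {a : ℝ} (ha : 0 < a) {w : ℂ}
    (hw : 0 < w.re + (Module.finrank ℝ V + n : ℝ) / 2) :
    Integrable (besselKernel p a w) (volume.prod (volume.restrict (Set.Ioi 0))) := by
  have hpm : Measurable p := hp.continuous.measurable
  have hm : Measurable (besselKernel p a w) := by
    unfold besselKernel
    fun_prop
  have hnorm (v : V) {t : ℝ} (ht : 0 < t) : ‖besselKernel p a w (v, t)‖ =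
      t ^ (w.re - 1) * Real.exp (-(a * t)) * (‖v‖ ^ n * Real.exp (-(a / t) * ‖v‖ ^ 2)) := by
    rw [besselKernel, norm_mul, norm_mul, hp.norm_eq, norm_cpow_eq_rpow_re_of_pos ht,
      Complex.norm_real, Real.norm_of_nonneg (Real.exp_pos _).le, sub_re, one_re, exp_bessel_eq]
    ring
  rw [integrable_prod_iff' hm.aestronglyMeasurable]
  constructor
  · filter_upwards [ae_restrict_mem measurableSet_Ioi] with t ht
    have ht : 0 < t := ht
    rw [← integrable_norm_iff (by exact (hm.comp measurable_prodMk_right).aestronglyMeasurable)]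
    simp only [hnorm _ ht]
    exact (integrable_norm_pow_mul_gaussian n (by positivity)).const_mul _
  · have h1 := (integrableOn_rpow_mul_exp ha hw).mul_const
      (a⁻¹ ^ ((Module.finrank ℝ V + n : ℝ) / 2) *
        ∫ v : V, ‖v‖ ^ n * Real.exp (-1 * ‖v‖ ^ 2))
    refine h1.congr ?_
    filter_upwards [ae_restrict_mem measurableSet_Ioi] with t ht
    have ht : 0 < t := ht
    simp only [hnorm _ ht]
    rw [integral_const_mul,
      integral_norm_pow_mul_gaussian n (b := a / t) (by positivity), inv_div,
      div_eq_mul_inv t a, Real.mul_rpow ht.le (by positivity), add_sub_right_comm,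
      Real.rpow_add ht]
    ring

theorem integrable_mul_besselIntegral (hp : FourierGaussian p n) {a : ℝ} (ha : 0 < a) {w : ℂ}
    (hw : 0 < w.re + (Module.finrank ℝ V + n : ℝ) / 2) :
    Integrable fun v => p v * besselIntegral a (‖v‖ ^ 2) w := by
  simp only [mul_besselIntegral]
  exact (hp.integrable_besselKernel ha hw).integral_prod_left

/-- After Fubini the inner transform is that of p times a Gaussian, and the remaining integral over
t is Euler's integral for Gamma. -/
theorem fourierInv_mul_besselIntegral (hp : FourierGaussian p n) {a : ℝ} (ha : 0 < a) {w : ℂ}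
    (hw : 0 < w.re + (Module.finrank ℝ V + n : ℝ) / 2) (y : V) :
    𝓕⁻ (fun v => p v * besselIntegral a (‖v‖ ^ 2) w) y =
      I ^ n * (((π / a) ^ (Module.finrank ℝ V / 2 + n : ℝ) : ℝ) : ℂ) * p y *
        (Gamma (w + (Module.finrank ℝ V / 2 + n : ℝ)) *
          (((a + π ^ 2 / a * ‖y‖ ^ 2)⁻¹ : ℝ) : ℂ) ^ (w + (Module.finrank ℝ V / 2 + n : ℝ))) := by
  set κ : ℝ := Module.finrank ℝ V / 2 + n with hκ
  have hK := hp.integrable_besselKernel ha hw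
  have hK' : Integrable (fun x : V × ℝ => (𝐞 (inner ℝ x.1 y) : ℂ) * besselKernel p a w x)
      (volume.prod (volume.restrict (Set.Ioi 0))) := by
    refine hK.mono (AEStronglyMeasurable.mul ?_ hK.1) (Filter.Eventually.of_forall fun x => ?_)
    · have : Continuous fun x : V × ℝ => (𝐞 (inner ℝ x.1 y) : ℂ) :=
        continuous_subtype_val.comp (Real.continuous_fourierChar.comp (by fun_prop))
      exact this.aestronglyMeasurable
    · rw [norm_mul, Circle.norm_coe, one_mul]
  have hκw : 0 < (w + κ : ℂ).re := by
    rw [add_re, ofReal_re, hκ]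
    have : (0 : ℝ) ≤ n := n.cast_nonneg
    linarith
  calc 𝓕⁻ (fun v => p v * besselIntegral a (‖v‖ ^ 2) w) y
      = ∫ v, ∫ t in Set.Ioi (0 : ℝ), (𝐞 (inner ℝ v y) : ℂ) * besselKernel p a w (v, t) := by
        rw [Real.fourierInv_eq]
        refine integral_congr_ae (Filter.Eventually.of_forall fun v => ?_)
        simp only [mul_besselIntegral, Circle.smul_def, smul_eq_mul, integral_const_mul]
    _ = ∫ t in Set.Ioi (0 : ℝ), ∫ v, (𝐞 (inner ℝ v y) : ℂ) * besselKernel p a w (v, t) :=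
        integral_integral_swap hK'
    _ = ∫ t in Set.Ioi (0 : ℝ), (I ^ n * (((π / a) ^ κ : ℝ) : ℂ) * p y) *
          ((t : ℂ) ^ (w + κ - 1) * cexp (-((a + π ^ 2 / a * ‖y‖ ^ 2 : ℝ) * t))) := by
        refine setIntegral_congr_fun measurableSet_Ioi fun t ht => ?_
        have ht : 0 < t := ht
        have h1 := hp.fourierInv_eq (b := a / t) (by positivity) y
        rw [Real.fourierInv_eq] at h1
        have h2 : ∀ v, (𝐞 (inner ℝ v y) : ℂ) * besselKernel p a w (v, t) =
            ((t : ℂ) ^ (w - 1) * (Real.exp (-(a * t)) : ℂ)) *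
              (𝐞 (inner ℝ v y) • (p v * (Real.exp (-(a / t) * ‖v‖ ^ 2) : ℂ))) := fun v => by
          rw [besselKernel, exp_bessel_eq, Circle.smul_def, smul_eq_mul, ofReal_mul]
          ring
        simp only [h2]
        rw [integral_const_mul, h1, ← hκ]
        have h3 : (π / (a / t)) ^ κ = (π / a) ^ κ * t ^ κ := by
          rw [← Real.mul_rpow (by positivity) ht.le]
          congr 1
          field_simp
        have h4 : (t : ℂ) ^ (w + κ - 1) = (t : ℂ) ^ (w - 1) * ((t ^ κ : ℝ) : ℂ) := by
          rw [add_sub_right_comm, cpow_add _ _ (by exact_mod_cast ht.ne'), ofReal_cpow ht.le]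
        have h5 : cexp (-((a + π ^ 2 / a * ‖y‖ ^ 2 : ℝ) * t)) =
            (Real.exp (-(a * t)) : ℂ) * (Real.exp (-(π ^ 2 / (a / t)) * ‖y‖ ^ 2) : ℂ) := by
          rw [← ofReal_mul (Real.exp _), ← Real.exp_add, ← ofReal_mul, ← ofReal_neg, ← ofReal_exp]
          congr 2
          field_simp
          ring
        rw [h3, h4, h5, ofReal_mul]
        ring
    _ = _ := by
        rw [integral_const_mul, integral_cpow_mul_exp_neg_mul_Ioi hκw (by positivity)]
        rw [one_div, ofReal_inv]
        ring

end FourierGaussian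

/-! ### Square integrability -/

theorem memLp_two_of_norm_le {F : V → ℂ} (hF : AEStronglyMeasurable F volume) {C κ : ℝ}
    (hκ : (Module.finrank ℝ V : ℝ) < 4 * κ)
    (h : ∀ y, ‖F y‖ ≤ C * (1 + ‖y‖ ^ 2) ^ (-κ)) : MemLp F 2 volume := by
  have h1 : MemLp (fun y : V => ((1 + ‖y‖ ^ 2) ^ (-κ) : ℝ)) 2 volume := by
    rw [memLp_two_iff_integrable_sq (Measurable.aestronglyMeasurable (by fun_prop))]
    refine (integrable_rpow_neg_one_add_norm_sq hκ).congr
      (Filter.Eventually.of_forall fun y => ?_)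
    simp only
    have h0 : (0 : ℝ) ≤ 1 + ‖y‖ ^ 2 := by positivity
    rw [← Real.rpow_mul_natCast h0]
    congr 1
    push_cast
    ring
  refine (h1.const_mul C).of_le hF (Filter.Eventually.of_forall fun y => (h y).trans ?_)
  exact Real.le_norm_self _

theorem FourierGaussian.norm_mul_cpow_le {p : V → ℂ} {n : ℕ} (hp : FourierGaussian p n) {c : ℝ}
    (hc : 0 < c) (e : ℂ) (y : V) :
    ‖p y * (((c * (1 + ‖y‖ ^ 2))⁻¹ : ℝ) : ℂ) ^ e‖ ≤
      c⁻¹ ^ e.re * (1 + ‖y‖ ^ 2) ^ (-(e.re - n / 2)) := by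
  have h0 : (0 : ℝ) < 1 + ‖y‖ ^ 2 := by positivity
  rw [norm_mul, hp.norm_eq, norm_cpow_eq_rpow_re_of_pos (by positivity), mul_inv,
    Real.mul_rpow (by positivity) (by positivity), Real.inv_rpow h0.le, ← Real.rpow_neg h0.le,
    neg_sub, sub_eq_add_neg, Real.rpow_add h0, ← mul_assoc, mul_comm (‖y‖ ^ n), mul_assoc]
  have h1 : ‖y‖ ^ n ≤ (1 + ‖y‖ ^ 2) ^ ((n : ℝ) / 2) := by
    rw [Real.rpow_div_two_eq_sqrt _ h0.le, Real.rpow_natCast]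
    gcongr
    exact Real.le_sqrt_of_sq_le (by linarith)
  gcongr

end Fourier

/-! ### Continuation in s, inversion, and complex powers. -/

theorem meromorphicContinuation_eq_of_differentiable {f g : ℂ → ℂ} {U : Set ℂ} (hU : IsOpen U)
    (hne : U.Nonempty) (hg : Differentiable ℂ g) (h : Set.EqOn g f U) :
    meromorphicContinuation f U = g := by
  have hgm : MeromorphicNFOn g Set.univ :=
    AnalyticOnNhd.meromorphicNFOn fun z _ => hg.analyticAt z
  have hex : ∃ g : ℂ → ℂ, MeromorphicNFOn g Set.univ ∧ Set.EqOn g f U := ⟨g, hgm, h⟩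
  rw [meromorphicContinuation, dif_pos hex]
  exact meromorphicContinuation_unique hU hne hex.choose_spec.1 hgm
    (hex.choose_spec.2.trans h.symm)

theorem isOpen_re_lt_half : IsOpen {s : ℂ | s.re < 1 / 2} :=
  isOpen_lt Complex.continuous_re continuous_const

theorem nonempty_re_lt_half : {s : ℂ | s.re < 1 / 2}.Nonempty := ⟨0, by simp⟩

/-- Inversion `x ↦ 1 / x` preserves null sets. -/
theorem ae_one_div {𝕜 : Type*} [RCLike 𝕜] [MeasurableSpace 𝕜] [BorelSpace 𝕜] (μ : Measure 𝕜)
    [μ.IsAddHaarMeasure] {P : 𝕜 → Prop} (h : ∀ᵐ x ∂μ, P x) : ∀ᵐ x ∂μ, P (1 / x) := by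
  have h1 : μ ((fun x : 𝕜 => x⁻¹) '' ({x | ¬ P x} \ {0})) = 0 := by
    refine addHaar_image_eq_zero_of_differentiableOn_of_addHaar_eq_zero μ (fun x hx => ?_)
      (measure_mono_null Set.sdiff_subset h)
    exact ((differentiableAt_inv (𝕜 := 𝕜) hx.2).restrictScalars ℝ).differentiableWithinAt
  have h2 : ∀ᵐ x ∂μ, x ≠ 0 := by simp [ae_iff]
  filter_upwards [measure_eq_zero_iff_ae_notMem.1 h1, h2] with x hx hx0
  by_contra hP
  exact hx ⟨1 / x, ⟨hP, by simpa using hx0⟩, by simp⟩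

theorem integrable_cpow_neg_one_add_norm_sq {V : Type*} [NormedAddCommGroup V]
    [InnerProductSpace ℝ V] [FiniteDimensional ℝ V] [MeasurableSpace V] [BorelSpace V] {c : ℝ}
    (hc : 0 < c) {e : ℂ} (he : (Module.finrank ℝ V : ℝ) < 2 * e.re) :
    Integrable fun y : V => (((c * (1 + ‖y‖ ^ 2))⁻¹ : ℝ) : ℂ) ^ e := by
  refine ((integrable_rpow_neg_one_add_norm_sq (E := V) (μ := volume) he).const_mul
    (c⁻¹ ^ e.re)).mono' (Measurable.aestronglyMeasurable (by fun_prop))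
    (Filter.Eventually.of_forall fun y => ?_)
  have := (fourierGaussian_one (V := V)).norm_mul_cpow_le hc e y
  simp only [one_mul] at this
  convert this using 2
  simp
  ring_nf

theorem ofReal_rpow_cpow {r : ℝ} (hr : 0 < r) (x : ℝ) (z : ℂ) :
    ((r ^ x : ℝ) : ℂ) ^ z = (r : ℂ) ^ (x * z) := by
  rw [cpow_def_of_ne_zero (ofReal_ne_zero.2 (Real.rpow_pos_of_pos hr x).ne'),
    cpow_def_of_ne_zero (ofReal_ne_zero.2 hr.ne'), ← ofReal_log hr.le,
    ← ofReal_log (Real.rpow_pos_of_pos hr x).le, Real.log_rpow hr]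
  push_cast
  ring_nf

theorem ofReal_inv_cpow {r : ℝ} (hr : 0 < r) (z : ℂ) : ((r⁻¹ : ℝ) : ℂ) ^ z = (r : ℂ) ^ (-z) := by
  rw [← Real.rpow_neg_one, ofReal_rpow_cpow hr]
  simp

theorem ofReal_pow_cpow {r : ℝ} (hr : 0 < r) (k : ℕ) (z : ℂ) :
    ((r ^ k : ℝ) : ℂ) ^ z = (r : ℂ) ^ (k * z) := by
  rw [← Real.rpow_natCast, ofReal_rpow_cpow hr]
  simp

/-! ### The real place -/

namespace RealPlace

theorem fourierInv_bessel {n : ℕ} (hn : n ≤ 1) {s : ℂ} (hs : s.re ≤ 1 / 2) :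
    𝓕⁻ (fun u : ℝ => (u : ℂ) ^ n * besselIntegral π (‖u‖ ^ 2) (1 / 2 - s)) = fun y : ℝ =>
      I ^ n * Gamma (1 - s + n) *
        ((y : ℂ) ^ n * (((π * (1 + ‖y‖ ^ 2))⁻¹ : ℝ) : ℂ) ^ (1 - s + n)) := by
  ext y
  rw [(fourierGaussian_real hn).fourierInv_mul_besselIntegral Real.pi_pos]
  · have h1 : (1 / 2 - s) + ((Module.finrank ℝ ℝ / 2 + n : ℝ) : ℂ) = 1 - s + n := by
      simp; ring
    have h2 : π + π ^ 2 / π * ‖y‖ ^ 2 = π * (1 + ‖y‖ ^ 2) := by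
      field_simp
    rw [h1, h2, div_self Real.pi_ne_zero, Real.one_rpow, ofReal_one]
    ring
  · have : (0 : ℝ) ≤ n := n.cast_nonneg
    simp
    linarith

theorem integrable_bessel {n : ℕ} (hn : n ≤ 1) {s : ℂ} (hs : s.re ≤ 1 / 2) :
    Integrable (fun u : ℝ => (u : ℂ) ^ n * besselIntegral π (‖u‖ ^ 2) (1 / 2 - s)) := by
  refine (fourierGaussian_real hn).integrable_mul_besselIntegral Real.pi_pos ?_
  have : (0 : ℝ) ≤ n := n.cast_nonneg
  simp
  linarith

theorem basicIntegral_eq {s : ℂ} (hs : s.re < 1 / 2) (u : ℝ) :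
    basicIntegral u s = besselIntegral π (u ^ 2) (1 / 2 - s) := by
  set h : ℝ → ℂ := fun u => besselIntegral π (‖u‖ ^ 2) (1 / 2 - s) with hh
  have hc : Continuous h := continuous_besselIntegral_norm_sq Real.pi_pos (by simpa using hs)
  have hi : Integrable h := by
    simpa only [pow_zero, one_mul] using integrable_bessel (n := 0) (by norm_num) hs.le
  have hF : 𝓕⁻ h = fun y : ℝ => Gamma (1 - s) * (((π * (1 + ‖y‖ ^ 2))⁻¹ : ℝ) : ℂ) ^ (1 - s) := by
    have := fourierInv_bessel (n := 0) (by norm_num) hs.le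
    simpa only [pow_zero, one_mul, Nat.cast_zero, add_zero] using this
  have hF' : 𝓕 h = fun y : ℝ => Gamma (1 - s) * (((π * (1 + ‖y‖ ^ 2))⁻¹ : ℝ) : ℂ) ^ (1 - s) := by
    ext y
    have := congrFun hF (-y)
    rwa [Real.fourierInv_eq_fourier_neg, neg_neg, norm_neg] at this
  have hFi : Integrable (𝓕 h) := by
    rw [hF']
    refine (integrable_cpow_neg_one_add_norm_sq Real.pi_pos ?_).const_mul _
    simp
    linarith
  -- Inversion at u writes the Bessel integral as the integral defining 𝕃; the factor π^(-(1-s))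
  -- Γ(1-s) is exactly the zeta factor at 2 - 2s.
  have h1 := congrFun (hc.fourierInv_fourier_eq hi hFi) u
  rw [Real.fourierInv_eq', hF'] at h1
  have h2 : h u = besselIntegral π (u ^ 2) (1 / 2 - s) := by simp [hh]
  rw [← h2, ← h1, basicIntegral, ← integral_const_mul]
  refine integral_congr_ae (Filter.Eventually.of_forall fun x => ?_)
  have hx : (0 : ℝ) < 1 + x ^ 2 := by positivity
  simp only [psi, zeta, height_nu, smul_eq_mul, Real.norm_eq_abs, sq_abs]
  have h3 : (((1 + x ^ 2) ^ (-(1 / 2) : ℝ) : ℝ) : ℂ) ^ (2 - 2 * s) =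
      (((1 + x ^ 2)⁻¹ : ℝ) : ℂ) ^ (1 - s) := by
    rw [ofReal_rpow_cpow hx, ofReal_inv_cpow hx]
    congr 1
    push_cast
    ring
  have h4 : (((π * (1 + x ^ 2))⁻¹ : ℝ) : ℂ) ^ (1 - s) =
      (π : ℂ) ^ (-(2 - 2 * s) / 2) * (((1 + x ^ 2)⁻¹ : ℝ) : ℂ) ^ (1 - s) := by
    rw [mul_inv, ofReal_mul, mul_cpow_ofReal_nonneg (by positivity) (by positivity),
      ofReal_inv_cpow Real.pi_pos]
    congr 2
    ring
  have h5 : (2 - 2 * s) / 2 = 1 - s := by ring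
  rw [h3, h4, h5]
  have h6 : cexp (2 * π * I * ((u * x : ℝ) : ℂ)) = cexp (((2 * π * inner ℝ x u : ℝ) : ℂ) * I) := by
    congr 1
    simp
    ring
  rw [h6]
  ring

theorem basicFunction_eq (s : ℂ) {u : ℝ} (hu : u ≠ 0) :
    basicFunction u s = besselIntegral π (u ^ 2) (1 / 2 - s) := by
  have h := meromorphicContinuation_eq_of_differentiable (f := basicIntegral u)
    (g := fun s => besselIntegral π (u ^ 2) (1 / 2 - s)) isOpen_re_lt_half nonempty_re_lt_half
    ((differentiable_besselIntegral Real.pi_pos (by positivity)).comp (by fun_prop))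
    (fun s hs => (basicIntegral_eq hs u).symm)
  rw [basicFunction, h]

theorem basicFunction_ae_eq (n : ℕ) (s : ℂ) :
    (fun u : ℝ => (u : ℂ) ^ n * basicFunction u s) =ᵐ[volume]
      fun u : ℝ => (u : ℂ) ^ n * besselIntegral π (‖u‖ ^ 2) (1 / 2 - s) := by
  have h2 : ∀ᵐ x : ℝ, x ≠ 0 := by simp [ae_iff]
  filter_upwards [h2] with u hu
  rw [basicFunction_eq s hu, Real.norm_eq_abs, sq_abs]

theorem memLp_weight {n : ℕ} (hn : n ≤ 1) (s C : ℂ) {τ : ℝ} (hτ : τ ≤ (1 - 2 * s).re / 2) :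
    MemLp (fun y : ℝ => (((1 + ‖y‖ ^ 2) ^ τ : ℝ) : ℂ) *
      (C * ((y : ℂ) ^ n * (((π * (1 + ‖y‖ ^ 2))⁻¹ : ℝ) : ℂ) ^ (1 - s + n)))) 2 volume := by
  refine memLp_two_of_norm_le (C := ‖C‖ * π⁻¹ ^ (1 - s + n).re)
    (κ := (1 - s + n).re - n / 2 - τ) (Measurable.aestronglyMeasurable (by fun_prop)) ?_ fun y => ?_
  · simp at hτ ⊢
    have : (0 : ℝ) ≤ n := n.cast_nonneg
    linarith
  · have h1 := (fourierGaussian_real hn).norm_mul_cpow_le Real.pi_pos (1 - s + n) y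
    rw [norm_mul, norm_mul, Complex.norm_real, Real.norm_of_nonneg (by positivity)]
    have h0 : (0 : ℝ) < 1 + ‖y‖ ^ 2 := by positivity
    calc _ ≤ (1 + ‖y‖ ^ 2) ^ τ * (‖C‖ * (π⁻¹ ^ (1 - s + n).re *
          (1 + ‖y‖ ^ 2) ^ (-((1 - s + n).re - n / 2)))) := by gcongr
      _ = _ := by
        rw [show -((1 - s + n : ℂ).re - n / 2 - τ) = τ + -((1 - s + n).re - n / 2) by ring,
          Real.rpow_add h0]
        ring

theorem inversion_eq (n : ℕ) (s C : ℂ) {x : ℝ} (hx : x ≠ 0) :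
    (vAbs x : ℂ) ^ (2 * s - 2) * (C * (((1 / x : ℝ) : ℂ) ^ n *
      (((π * (1 + ‖1 / x‖ ^ 2))⁻¹ : ℝ) : ℂ) ^ (1 - s + n))) =
    C * ((x : ℂ) ^ n * (((π * (1 + ‖x‖ ^ 2))⁻¹ : ℝ) : ℂ) ^ (1 - s + n)) := by
  have hx' : 0 < ‖x‖ := norm_pos_iff.2 hx
  have hxc : (x : ℂ) ≠ 0 := ofReal_ne_zero.2 hx
  have hnc : ((‖x‖ : ℝ) : ℂ) ≠ 0 := ofReal_ne_zero.2 hx'.ne'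
  have h1 : (π * (1 + ‖1 / x‖ ^ 2))⁻¹ = ‖x‖ ^ 2 * (π * (1 + ‖x‖ ^ 2))⁻¹ := by
    rw [norm_div, norm_one]
    field_simp
    ring
  have h2 : (((‖x‖ ^ 2 : ℝ)) : ℂ) ^ (1 - s + n) =
      ((‖x‖ : ℝ) : ℂ) ^ (2 - 2 * s) * ((‖x‖ : ℝ) : ℂ) ^ (2 * n) := by
    rw [← cpow_natCast, ← cpow_add _ _ hnc, ofReal_pow_cpow hx']
    congr 1
    push_cast
    ring
  have h3 : (((‖x‖ : ℝ) : ℂ) ^ (2 * s - 2)) * ((‖x‖ : ℝ) : ℂ) ^ (2 - 2 * s) = 1 := by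
    rw [← cpow_add _ _ hnc]
    simp
  have h4 : ((‖x‖ : ℝ) : ℂ) ^ (2 * n) = (x : ℂ) ^ n * (x : ℂ) ^ n := by
    rw [pow_mul, ← ofReal_pow, Real.norm_eq_abs, sq_abs, ← mul_pow]
    push_cast
    ring
  have hv : vAbs x = ‖x‖ := by simp [vAbs]
  rw [h1, hv, ofReal_mul, mul_cpow_ofReal_nonneg (by positivity) (by positivity), h2, h4,
    one_div, ofReal_inv, inv_pow]
  have h5 : ((x : ℂ) ^ n)⁻¹ * ((x : ℂ) ^ n) = 1 := inv_mul_cancel₀ (pow_ne_zero _ hxc)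
  linear_combination (C * ((x : ℂ) ^ n * (((π * (1 + ‖x‖ ^ 2))⁻¹ : ℝ) : ℂ) ^ (1 - s + n))) *
    (((x : ℂ) ^ n)⁻¹ * ((x : ℂ) ^ n) * h3 + h5)

theorem memSobolev_and_hankel {n : ℕ} (hn : n ≤ 1) {s : ℂ} (hs : s.re ≤ 1 / 2) :
    MemSobolev (1 - 2 * s) (fun u => (u : ℂ) ^ n * basicFunction u s) ∧
      hankel s (fun u => (u : ℂ) ^ n * basicFunction u s) =ᵐ[volume]
        fun u => (-1) ^ n * ((u : ℂ) ^ n * basicFunction u s) := by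
  have hfh := basicFunction_ae_eq n s
  have hG := fourierInv_bessel hn hs
  set h : ℝ → ℂ := fun u => (u : ℂ) ^ n * besselIntegral π (‖u‖ ^ 2) (1 / 2 - s) with hh
  have hGm : MemLp (𝓕⁻ h) 2 volume := by
    rw [hG]
    have := memLp_weight hn s (I ^ n * Gamma (1 - s + n)) (τ := 0) (by simp; linarith)
    simpa using this
  obtain ⟨h2, hF, hFF⟩ := fourier_of_integrable (integrable_bessel hn hs) hGm
  have hfF : fourier (fun u => (u : ℂ) ^ n * basicFunction u s) =ᵐ[volume] 𝓕⁻ h := by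
    rw [fourier_congr hfh]
    exact hF
  refine ⟨⟨(memLp_congr_ae hfh).2 h2, ?_⟩, ?_⟩
  · refine (memLp_congr_ae ?_).1
      (memLp_weight hn s (I ^ n * Gamma (1 - s + n)) (τ := (1 - 2 * s).re / 2) le_rfl)
    filter_upwards [hfF] with y hy
    rw [hy, hG]
    simp [vAbs]
  · have hinv : (fun x : ℝ => (vAbs x : ℂ) ^ (2 * s - 2) *
        fourier (fun u => (u : ℂ) ^ n * basicFunction u s) (1 / x)) =ᵐ[volume] 𝓕⁻ h := by
      have hne : ∀ᵐ x : ℝ, x ≠ 0 := by simp [ae_iff]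
      filter_upwards [ae_one_div volume hfF, hne] with x hx hx0
      rw [hx, hG]
      exact inversion_eq n s _ hx0
    rw [hankel, fourier_congr hinv]
    filter_upwards [hFF, hfh] with u hu hu'
    rw [hu, hu']
    simp only [hh, norm_neg, ofReal_neg]
    rw [neg_pow]
    ring

end RealPlace

/-! ### The complex place -/

namespace ComplexPlace

theorem integrable_bessel {p : ℂ → ℂ} {n : ℕ} (hp : FourierGaussian p n) {s : ℂ}
    (hs : s.re ≤ 1 / 2) :
    Integrable (fun u : ℂ => 2 * π * (p u * besselIntegral (2 * π) (‖u‖ ^ 2) (1 - 2 * s))) := by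
  refine (hp.integrable_mul_besselIntegral Real.two_pi_pos ?_).const_mul _
  have : (0 : ℝ) ≤ n := n.cast_nonneg
  simp
  linarith

theorem fourierInv_bessel {p : ℂ → ℂ} {n : ℕ} (hp : FourierGaussian p n)
    (hom : ∀ (c : ℝ) (x : ℂ), p (c * x) = (c : ℂ) ^ n * p x) {s : ℂ} (hs : s.re ≤ 1 / 2) (x : ℂ) :
    2 * 𝓕⁻ (fun u : ℂ => 2 * π * (p u * besselIntegral (2 * π) (‖u‖ ^ 2) (1 - 2 * s)))
        (2 * conj x) =
      (2 * π * I ^ n * Gamma (2 - 2 * s + n)) *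
        (p (conj x) * (((2 * π * (1 + ‖x‖ ^ 2))⁻¹ : ℝ) : ℂ) ^ (2 - 2 * s + n)) := by
  have h0 : 𝓕⁻ (fun u : ℂ => 2 * π * (p u * besselIntegral (2 * π) (‖u‖ ^ 2) (1 - 2 * s)))
      (2 * conj x) =
      2 * π * 𝓕⁻ (fun u : ℂ => p u * besselIntegral (2 * π) (‖u‖ ^ 2) (1 - 2 * s))
        (2 * conj x) := by
    simp only [Real.fourierInv_eq]
    rw [← integral_const_mul]
    refine integral_congr_ae (Filter.Eventually.of_forall fun u => ?_)
    simp only [Circle.smul_def, smul_eq_mul]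
    ring
  rw [h0, hp.fourierInv_mul_besselIntegral Real.two_pi_pos]
  · have h1 : (1 - 2 * s) + ((Module.finrank ℝ ℂ / 2 + n : ℝ) : ℂ) = 2 - 2 * s + n := by
      simp; ring
    have h2 : 2 * π + π ^ 2 / (2 * π) * ‖2 * conj x‖ ^ 2 = 2 * π * (1 + ‖x‖ ^ 2) := by
      simp
      field_simp
    have h3 : (π / (2 * π)) ^ (Module.finrank ℝ ℂ / 2 + n : ℝ) = (2⁻¹ : ℝ) ^ (n + 1) := by
      rw [← Real.rpow_natCast, finrank_real_complex]
      congr 1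
      · field_simp
      · push_cast; ring
    have h4 : p (2 * conj x) = 2 ^ n * p (conj x) := by
      have := hom 2 (conj x)
      push_cast at this
      exact this
    have h5 : (2⁻¹ : ℂ) ^ n * 2 ^ n = 1 := by rw [← mul_pow]; simp
    rw [h1, h2, h3, h4, ofReal_pow, ofReal_inv, ofReal_ofNat, pow_succ]
    linear_combination (2 * π * I ^ n * Gamma (2 - 2 * s + n)) *
        (p (conj x) * (((2 * π * (1 + ‖x‖ ^ 2))⁻¹ : ℝ) : ℂ) ^ (2 - 2 * s + n)) * h5
  · have : (0 : ℝ) ≤ n := n.cast_nonneg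
    simp
    linarith

theorem basicIntegral_eq {s : ℂ} (hs : s.re < 1 / 2) (u : ℂ) :
    basicIntegral u s = 2 * π * besselIntegral (2 * π) (‖u‖ ^ 2) (1 - 2 * s) := by
  set h : ℂ → ℂ := fun u => besselIntegral (2 * π) (‖u‖ ^ 2) (1 - 2 * s) with hh
  have hre : 0 < (1 - 2 * s).re := by simp; linarith
  have hc : Continuous h := continuous_besselIntegral_norm_sq Real.two_pi_pos hre
  have hone := fourierGaussian_one (V := ℂ)
  have hpos : 0 < (1 - 2 * s).re + (Module.finrank ℝ ℂ + (0 : ℕ) : ℝ) / 2 := by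
    positivity
  have hi : Integrable h := by
    simpa only [one_mul] using hone.integrable_mul_besselIntegral Real.two_pi_pos hpos
  have hF (y : ℂ) : 𝓕 h y = (1 / 2) * (Gamma (2 - 2 * s) *
      (((2 * π * (1 + ‖(1 / 2 : ℝ) • y‖ ^ 2))⁻¹ : ℝ) : ℂ) ^ (2 - 2 * s)) := by
    have h1 := hone.fourierInv_mul_besselIntegral Real.two_pi_pos hpos (-y)
    simp only [one_mul] at h1
    rw [Real.fourierInv_eq_fourier_neg, neg_neg, norm_neg] at h1
    have h2 : (1 - 2 * s) + ((Module.finrank ℝ ℂ / 2 + (0 : ℕ) : ℝ) : ℂ) = 2 - 2 * s := by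
      simp; ring
    have h3 : 2 * π + π ^ 2 / (2 * π) * ‖y‖ ^ 2 = 2 * π * (1 + ‖(1 / 2 : ℝ) • y‖ ^ 2) := by
      rw [norm_smul, Real.norm_of_nonneg (by norm_num)]
      field_simp
    have h4 : (π / (2 * π)) ^ (Module.finrank ℝ ℂ / 2 + (0 : ℕ) : ℝ) = (1 / 2 : ℝ) := by
      rw [finrank_real_complex]
      simp
      field_simp
    rw [h2, h3, h4] at h1
    rw [h1]
    push_cast
    ring
  have hFi : Integrable (𝓕 h) := by
    rw [funext hF]
    refine (Integrable.const_mul ?_ _).const_mul _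
    have h1 := integrable_cpow_neg_one_add_norm_sq (V := ℂ) (e := 2 - 2 * s) Real.two_pi_pos
      (by simp; linarith)
    exact h1.comp_smul (R := 1 / 2) (by norm_num)
  have h1 := congrFun (hc.fourierInv_fourier_eq hi hFi) u
  rw [Real.fourierInv_eq'] at h1
  -- The substitution v = 2 conj x turns the real inner product into ψ(ux). Its Jacobian 4 times the
  -- 1/2 in `hF` is the 2 of the self-dual measure.
  have h2 := integral_comp_two_mul_conj
    fun v => cexp (((2 * π * inner ℝ v u : ℝ) : ℂ) * I) • 𝓕 h v
  rw [h1] at h2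
  have h3 : besselIntegral (2 * π) (‖u‖ ^ 2) (1 - 2 * s) = 4 * ∫ x : ℂ,
      cexp (((2 * π * inner ℝ (2 * conj x) u : ℝ) : ℂ) * I) • 𝓕 h (2 * conj x) := by
    rw [h2]
    simp only [hh]
    ring
  rw [h3, basicIntegral, selfDual, integral_smul_measure, ENNReal.toReal_ofNat, real_smul,
    ← integral_const_mul, ← integral_const_mul, ← integral_const_mul, ← integral_const_mul]
  refine integral_congr_ae (Filter.Eventually.of_forall fun x => ?_)
  have h4 : ‖(1 / 2 : ℝ) • (2 * conj x)‖ = ‖x‖ := by simp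
  have h5 : cexp (((2 * π * inner ℝ (2 * conj x) u : ℝ) : ℂ) * I) = psi (u * x) := by
    rw [psi]
    congr 1
    simp [Complex.inner]
    ring
  have h6 : (((2 * π * (1 + ‖x‖ ^ 2))⁻¹ : ℝ) : ℂ) ^ (2 - 2 * s) =
      (2 * π : ℂ) ^ (-(2 - 2 * s)) * (((1 + ‖x‖ ^ 2)⁻¹ : ℝ) : ℂ) ^ (2 - 2 * s) := by
    rw [mul_inv, ofReal_mul, mul_cpow_ofReal_nonneg (by positivity) (by positivity),
      ofReal_inv_cpow Real.two_pi_pos]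
    push_cast
    rfl
  have h7 : (2 * π : ℂ) ^ (1 - (2 - 2 * s)) = 2 * π * (2 * π : ℂ) ^ (-(2 - 2 * s)) := by
    rw [sub_eq_add_neg, cpow_add _ _ (by simp [Real.pi_ne_zero]), cpow_one]
  simp only [hF, h4, h5, height_nu, zeta, h6, h7, smul_eq_mul, ofReal_ofNat]
  ring

theorem basicFunction_eq (s : ℂ) {u : ℂ} (hu : u ≠ 0) :
    basicFunction u s = 2 * π * besselIntegral (2 * π) (‖u‖ ^ 2) (1 - 2 * s) := by
  have hu' : 0 < ‖u‖ := norm_pos_iff.2 hu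
  have h := meromorphicContinuation_eq_of_differentiable (f := basicIntegral u)
    (g := fun s => 2 * π * besselIntegral (2 * π) (‖u‖ ^ 2) (1 - 2 * s)) isOpen_re_lt_half
    nonempty_re_lt_half
    (((differentiable_besselIntegral Real.two_pi_pos (by positivity)).comp
      (by fun_prop)).const_mul _)
    (fun s hs => (basicIntegral_eq hs u).symm)
  rw [basicFunction, h]

theorem basicFunction_ae_eq (p : ℂ → ℂ) (s : ℂ) :
    (fun u : ℂ => p u * basicFunction u s) =ᵐ[volume]
      fun u : ℂ => 2 * π * (p u * besselIntegral (2 * π) (‖u‖ ^ 2) (1 - 2 * s)) := by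
  have h2 : ∀ᵐ x : ℂ, x ≠ 0 := by simp [ae_iff]
  filter_upwards [h2] with u hu
  rw [basicFunction_eq s hu]
  ring

theorem memLp_weight {p : ℂ → ℂ} {n : ℕ} (hp : FourierGaussian p n) {s : ℂ} (C : ℂ) {W : ℂ → ℝ}
    (hWm : Measurable W) (hW0 : ∀ y, 0 ≤ W y)
    (hW : ∀ y, W y ≤ (1 + ‖y‖ ^ 2) ^ (1 - 2 * s).re) :
    MemLp (fun y : ℂ => (W y : ℂ) *
      (C * (p y * (((2 * π * (1 + ‖y‖ ^ 2))⁻¹ : ℝ) : ℂ) ^ (2 - 2 * s + n)))) 2 volume := by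
  have hpm : Measurable p := hp.continuous.measurable
  refine memLp_two_of_norm_le (C := ‖C‖ * (2 * π)⁻¹ ^ (2 - 2 * s + n).re)
    (κ := (2 - 2 * s + n).re - n / 2 - (1 - 2 * s).re)
    (Measurable.aestronglyMeasurable (by fun_prop)) ?_ fun y => ?_
  · simp
    have : (0 : ℝ) ≤ n := n.cast_nonneg
    linarith
  · have h1 := hp.norm_mul_cpow_le Real.two_pi_pos (2 - 2 * s + n) y
    rw [norm_mul, norm_mul, Complex.norm_real, Real.norm_of_nonneg (hW0 y)]
    have h0 : (0 : ℝ) < 1 + ‖y‖ ^ 2 := by positivity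
    have h2 := hW y
    calc _ ≤ (1 + ‖y‖ ^ 2) ^ (1 - 2 * s).re * (‖C‖ * ((2 * π)⁻¹ ^ (2 - 2 * s + n).re *
          (1 + ‖y‖ ^ 2) ^ (-((2 - 2 * s + n).re - n / 2)))) := by gcongr
      _ = _ := by
        rw [show -((2 - 2 * s + n : ℂ).re - n / 2 - (1 - 2 * s).re) =
          (1 - 2 * s).re + -((2 - 2 * s + n).re - n / 2) by ring, Real.rpow_add h0]
        ring

theorem inversion_eq {p : ℂ → ℂ} {n : ℕ}
    (hom : ∀ (c : ℝ) (x : ℂ), p (c * x) = (c : ℂ) ^ n * p x) (s C : ℂ) {x : ℂ} (hx : x ≠ 0) :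
    (vAbs x : ℂ) ^ (2 * s - 2) * (C * (p (conj (1 / x)) *
      (((2 * π * (1 + ‖1 / x‖ ^ 2))⁻¹ : ℝ) : ℂ) ^ (2 - 2 * s + n))) =
    C * (p x * (((2 * π * (1 + ‖x‖ ^ 2))⁻¹ : ℝ) : ℂ) ^ (2 - 2 * s + n)) := by
  have hx' : 0 < ‖x‖ := norm_pos_iff.2 hx
  set r : ℝ := ‖x‖ ^ 2 with hr
  have hr0 : 0 < r := by positivity
  have hrc : (r : ℂ) ≠ 0 := ofReal_ne_zero.2 hr0.ne'
  have h1 : (2 * π * (1 + ‖1 / x‖ ^ 2))⁻¹ = r * (2 * π * (1 + r))⁻¹ := by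
    rw [norm_div, norm_one, div_pow, ← hr]
    field_simp
    ring
  have h2 : (r : ℂ) ^ (2 - 2 * s + n) = (r : ℂ) ^ (2 - 2 * s) * (r : ℂ) ^ n := by
    rw [cpow_add _ _ hrc, cpow_natCast]
  have h3 : (r : ℂ) ^ (2 * s - 2) * (r : ℂ) ^ (2 - 2 * s) = 1 := by
    rw [← cpow_add _ _ hrc]
    simp
  have hv : vAbs x = r := by simp [vAbs, hr]
  have h4 : conj (1 / x) = ((r⁻¹ : ℝ) : ℂ) * x := by
    have hcx : conj x ≠ 0 := (map_ne_zero _).2 hx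
    rw [map_div₀, map_one, ofReal_inv, hr, ofReal_pow, ← conj_mul']
    field_simp
  rw [h1, hv, ofReal_mul, mul_cpow_ofReal_nonneg (by positivity) (by positivity), h2, h4, hom,
    ofReal_inv, inv_pow]
  have h5 : ((r : ℂ) ^ n)⁻¹ * (r : ℂ) ^ n = 1 := inv_mul_cancel₀ (pow_ne_zero _ hrc)
  linear_combination (C * (p x * (((2 * π * (1 + r))⁻¹ : ℝ) : ℂ) ^ (2 - 2 * s + n))) *
    (((r : ℂ) ^ n)⁻¹ * (r : ℂ) ^ n * h3 + h5)

/-- The functions p and q are exchanged by conjugation of the variable: the transform of p𝕃 carries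
q, and inverting it gives the transform of q𝕃. -/
theorem memSobolev_and_hankel {p q : ℂ → ℂ} {n : ℕ} (hp : FourierGaussian p n)
    (hq : FourierGaussian q n) (homp : ∀ (c : ℝ) (x : ℂ), p (c * x) = (c : ℂ) ^ n * p x)
    (homq : ∀ (c : ℝ) (x : ℂ), q (c * x) = (c : ℂ) ^ n * q x) (hpq : ∀ x, p (conj x) = q x)
    {s : ℂ} (hs : s.re ≤ 1 / 2) :
    MemSobolev (1 - 2 * s) (fun u => p u * basicFunction u s) ∧
      hankel s (fun u => p u * basicFunction u s) =ᵐ[volume]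
        fun u => (-1) ^ n * (q u * basicFunction u s) := by
  have hqp (x : ℂ) : q (conj x) = p x := by rw [← hpq, conj_conj]
  have hGp := funext (fourierInv_bessel hp homp hs)
  have hGq := funext (fourierInv_bessel hq homq hs)
  have hfp := basicFunction_ae_eq p s
  have hfq := basicFunction_ae_eq q s
  set h : ℂ → ℂ := fun u => 2 * π * (p u * besselIntegral (2 * π) (‖u‖ ^ 2) (1 - 2 * s)) with hh
  set k : ℂ → ℂ := fun u => 2 * π * (q u * besselIntegral (2 * π) (‖u‖ ^ 2) (1 - 2 * s)) with hk
  simp only [hpq] at hGp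
  simp only [hqp] at hGq
  set C : ℂ := 2 * π * I ^ n * Gamma (2 - 2 * s + n) with hC
  have hre : 0 ≤ (1 - 2 * s).re := by simp; linarith
  have hone : ∀ y : ℂ, (1 : ℝ) ≤ (1 + ‖y‖ ^ 2) ^ (1 - 2 * s).re := fun y =>
    Real.one_le_rpow (by linarith [sq_nonneg ‖y‖]) hre
  have hGpm : MemLp (fun x => 2 * 𝓕⁻ h (2 * conj x)) 2 volume := by
    rw [hGp]
    have := memLp_weight hq C (W := fun _ => 1) measurable_const (fun _ => zero_le_one) hone
    simpa only [ofReal_one, one_mul] using this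
  have hGqm : MemLp (fun x => 2 * 𝓕⁻ k (2 * conj x)) 2 volume := by
    rw [hGq]
    have := memLp_weight hp C (W := fun _ => 1) measurable_const (fun _ => zero_le_one) hone
    simpa only [ofReal_one, one_mul] using this
  obtain ⟨h2, hF, -⟩ := fourier_of_integrable (integrable_bessel hp hs) hGpm
  obtain ⟨-, -, hKK⟩ := fourier_of_integrable (integrable_bessel hq hs) hGqm
  have hfF : fourier (fun u => p u * basicFunction u s) =ᵐ[volume]
      fun x => C * (q x * (((2 * π * (1 + ‖x‖ ^ 2))⁻¹ : ℝ) : ℂ) ^ (2 - 2 * s + n)) := by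
    rw [fourier_congr hfp, ← hGp]
    exact hF
  refine ⟨⟨((memLp_congr_ae hfp).2 h2).smul_measure (by simp), ?_⟩, ?_⟩
  · refine MemLp.smul_measure ?_ (by simp)
    refine (memLp_congr_ae ?_).1 (memLp_weight hq (s := s) C
      (W := fun y => (1 + vAbs y ^ 2) ^ ((1 - 2 * s).re / 2)) ?_ (fun y => ?_) fun y => ?_)
    · filter_upwards [hfF] with y hy
      rw [hy]
    · unfold vAbs
      fun_prop
    · positivity
    -- Since |y|_v = ‖y‖², the Sobolev weight is at most (1 + ‖y‖²) ^ Re(1 - 2s).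
    · have h3 : 1 + vAbs y ^ 2 ≤ (1 + ‖y‖ ^ 2) ^ 2 := by
        rw [vAbs, finrank_real_complex]
        nlinarith [sq_nonneg ‖y‖]
      have h4 : (0 : ℝ) ≤ 1 + ‖y‖ ^ 2 := by positivity
      calc (1 + vAbs y ^ 2) ^ ((1 - 2 * s).re / 2)
          ≤ ((1 + ‖y‖ ^ 2) ^ 2) ^ ((1 - 2 * s).re / 2) :=
            Real.rpow_le_rpow (by positivity) h3 (by positivity)
        _ = (1 + ‖y‖ ^ 2) ^ (1 - 2 * s).re := by
            rw [← Real.rpow_natCast, ← Real.rpow_mul h4]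
            congr 1
            push_cast
            ring
  · have hinv : (fun x : ℂ => (vAbs x : ℂ) ^ (2 * s - 2) *
        fourier (fun u => p u * basicFunction u s) (1 / x)) =ᵐ[volume]
          fun x => 2 * 𝓕⁻ k (2 * conj x) := by
      have hne : ∀ᵐ x : ℂ, x ≠ 0 := by simp [ae_iff]
      filter_upwards [ae_one_div volume hfF, hne] with x hx hx0
      rw [hx, congrFun hGq x, ← inversion_eq homp s C hx0, hpq]
    rw [hankel, fourier_congr hinv]
    filter_upwards [hKK, hfq] with u hu hu'
    have hneg : q (-u) = (-1) ^ n * q u := by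
      have := homq (-1) u
      simpa using this
    rw [hu, hu']
    simp only [hk, norm_neg, hneg]
    ring

end ComplexPlace

end ArchHankel

theorem mainTheorem11 (s : ℂ) (hs : s.re ≤ 1 / 2) :
    (∀ n : ℕ,
      ArchHankel.ComplexPlace.MemSobolev (1 - 2 * s)
        (fun u => u ^ n * ArchHankel.ComplexPlace.basicFunction u s) ∧
      ArchHankel.ComplexPlace.MemSobolev (1 - 2 * s)
        (fun u => conj u ^ n * ArchHankel.ComplexPlace.basicFunction u s) ∧
      ArchHankel.ComplexPlace.hankel s
          (fun u => u ^ n * ArchHankel.ComplexPlace.basicFunction u s) =ᵐ[volume]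
        (fun u => (-1) ^ n * (conj u ^ n * ArchHankel.ComplexPlace.basicFunction u s)) ∧
      ArchHankel.ComplexPlace.hankel s
          (fun u => conj u ^ n * ArchHankel.ComplexPlace.basicFunction u s) =ᵐ[volume]
        (fun u => (-1) ^ n * (u ^ n * ArchHankel.ComplexPlace.basicFunction u s))) ∧
    (∀ n : ℕ, n ≤ 1 →
      ArchHankel.RealPlace.MemSobolev (1 - 2 * s)
        (fun u => (u : ℂ) ^ n * ArchHankel.RealPlace.basicFunction u s) ∧
      ArchHankel.RealPlace.hankel s
          (fun u => (u : ℂ) ^ n * ArchHankel.RealPlace.basicFunction u s) =ᵐ[volume]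
        (fun u => (-1) ^ n * ((u : ℂ) ^ n * ArchHankel.RealPlace.basicFunction u s))) := by
  refine ⟨fun n => ?_, fun n hn => ArchHankel.RealPlace.memSobolev_and_hankel hn hs⟩
  have hp := ArchHankel.fourierGaussian_pow n
  have hq := ArchHankel.fourierGaussian_conj_pow n
  have homp (c : ℝ) (x : ℂ) : (c * x) ^ n = (c : ℂ) ^ n * x ^ n := mul_pow _ _ _
  have homq (c : ℝ) (x : ℂ) : conj (c * x) ^ n = (c : ℂ) ^ n * conj x ^ n := by
    rw [map_mul, conj_ofReal, mul_pow]
  obtain ⟨h1, h2⟩ := ArchHankel.ComplexPlace.memSobolev_and_hankel hp hq homp homq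
    (fun _ => rfl) hs
  obtain ⟨h3, h4⟩ := ArchHankel.ComplexPlace.memSobolev_and_hankel hq hp homq homp
    (fun x => by rw [conj_conj]) hs
  exact ⟨h1, h3, h2, h4⟩
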